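/- For a topological space $X$, the dimension $\dim X$ is the supremum of the lengths of chains of irreducible closed subsets of $X$; for an irreducible closed subset $Z\subseteq X$, the codimension $\operatorname{codim}(Z,X)$ is the supremum of the lengths $n$ of chains $Z=Z_0\subsetneq Z_1\subsetneq\cdots\subsetneq Z_n$ of irreducible closed subsets of $X$. A scheme is called equidimensional if all its irreducible components have the same dimension. **Lemma.** Let $R$ be a complete local noetherian ring with maximal ideal $\mathfrak m$, let $S:=(\operatorname{Spec} R)\setminus\{\mathfrak m\}$ be its punctured spectrum, and let $X$ be an equidimensional scheme, locally of finite type over $S$. Then the dimension formula holds for $X$: for every irreducible closed subset $Z$ of $X$, $$\dim Z+\operatorname{codim}(Z,X)=\dim X.$$ -/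

import Mathlib

open CategoryTheory AlgebraicGeometry TopologicalSpace

universe u

/-- The codimension `codim(Z, X)` of an irreducible closed subset `Z` of `X`: the supremum of the
lengths `n` of chains `Z = Z₀ ⊂ Z₁ ⊂ ⋯ ⊂ Zₙ` of irreducible closed subsets of `X`. -/
noncomputable def topologicalCodim {X : Type*} [TopologicalSpace X]
    (Z : IrreducibleCloseds X) : ℕ∞ :=
  Order.coheight Z

/-- A topological space is equidimensional if all its irreducible components have the same
dimension. -/
def IsEquidimensionalSpace (X : Type*) [TopologicalSpace X] : Prop :=
  ∀ Y ∈ irreducibleComponents X, ∀ Y' ∈ irreducibleComponents X,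
    topologicalKrullDim Y = topologicalKrullDim Y'

/-- The dimension formula holds for `X` if `dim Z + codim(Z, X) = dim X` for all irreducible
closed subsets `Z` of `X`. -/
def DimensionFormulaHolds (X : Type*) [TopologicalSpace X] : Prop :=
  ∀ Z : IrreducibleCloseds X,
    topologicalKrullDim (Z : Set X) + (topologicalCodim Z : WithBot ℕ∞) = topologicalKrullDim X

/-- The open subset `Spec R ∖ {𝔪}` of the spectrum of a local ring `R`. -/
noncomputable def puncturedSpectrumOpens (R : Type u) [CommRing R] [IsLocalRing R] :
    (Spec (CommRingCat.of R)).Opens where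
  carrier := {IsLocalRing.closedPoint R}ᶜ
  is_open' := (IsLocalRing.isClosed_singleton_closedPoint R).isOpen_compl

/-- The punctured spectrum of a local ring `R`, as an open subscheme of `Spec R`. -/
noncomputable def puncturedSpectrum (R : Type u) [CommRing R] [IsLocalRing R] : Scheme.{u} :=
  (puncturedSpectrumOpens R).toScheme

/-! The formula follows from a stronger local statement. In the poset of irreducible closed subsets,
call heights additive if `dim Z` plus the length of the interval `[Z, Y]` equals `dim Y` whenever `Z
≤ Y`. Every irreducible closed set lies in a component and all components have the same dimension,
so additivity gives `dim Z + codim(Z, X) = dim X`.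

Additivity is checked on affine charts `Spec B`, with `B` of finite type over `R` and some `g ∈ 𝔪`
invertible in `B`. Such rings are Jacobson, so `X` is a Jacobson space. Any two charts meeting `Y`
then share a closed point of `X` lying on `Y`. Additivity in a chart measures the height of `Y` by
chains down to any closed point, so this height does not depend on the chart and equals the height
in `X`.

On a chart one may take `B` to be a domain, with `p` the kernel of `R → B`. By Cohen's structure
theory, `R ⧸ p` is a quotient of a Cohen-Macaulay local ring `Q`, a power series ring over a field
or a discrete valuation ring. Lift the class of `g` to `f` in the maximal ideal of `Q`; then `B` is
a quotient of a polynomial ring over `Q[1/f]`. By a prime avoidance argument, primes of `Q` maximal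
among those missing `f` have one-dimensional quotient. Hence `Q[1/f]` is Jacobson and all its
maximal ideals have height `dim Q - 1`. Polynomial rings over it inherit constant height of maximal
ideals and Cohen-Macaulay localizations (`IsEquicodimensionalCM`), and every quotient domain of such
a ring satisfies `ht q + dim B ⧸ q = dim B`.

Two classical inputs are proved on the way: coefficient rings, built from a tower of subrings
generated by `p`-th powers, `p`-multiples and lifts of a `p`-basis; and `ht Q + dim R ⧸ Q = dim R`
for Cohen-Macaulay local rings, obtained from depth and Ext. -/

section CoefficientRing

/-! ### p-bases and rings generated by p-th powers -/

/-- A subring of a field of characteristic exponent `p` containing all `p`-th powers is closed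
under inversion. -/
theorem Subring.inv_mem_of_pow_mem {K : Type*} [Field K] {p : ℕ} (hp : p ≠ 0) (L : Subring K)
    (hL : ∀ x : K, x ^ p ∈ L) {x : K} (hx : x ∈ L) : x⁻¹ ∈ L := by
  by_cases h0 : x = 0
  · simp [h0]
  · have : x⁻¹ = x ^ (p - 1) * (x⁻¹) ^ p := by
      obtain ⟨q, rfl⟩ := Nat.exists_eq_succ_of_ne_zero hp
      rw [Nat.succ_sub_one, pow_succ, ← mul_assoc, ← mul_pow, mul_inv_cancel₀ h0, one_pow, one_mul]
    rw [this]
    exact L.mul_mem (L.pow_mem hx _) (hL _)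

/-- `L` is a field because it contains all `p`-th powers. Frobenius is injective, so `t ^ p` has no
`p`-th root in `L` and `X ^ p - t ^ p` is the minimal polynomial of `t`; a relation of degree below
`p` must be trivial. -/
theorem Subring.eq_zero_of_sum_pow_eq_zero {K : Type*} [Field K] {p : ℕ} (hp : p.Prime)
    [CharP K p] (L : Subring K) (hL : ∀ x : K, x ^ p ∈ L) {t : K} (ht : t ∉ L) (c : ℕ → K)
    (hc : ∀ j, c j ∈ L) (h : ∑ j ∈ Finset.range p, c j * t ^ j = 0) : ∀ j < p, c j = 0 := by
  have := Fact.mk hp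
  let F : Subfield K := { L with inv_mem' := fun x hx => L.inv_mem_of_pow_mem hp.ne_zero hL hx }
  have hirr : Irreducible (Polynomial.X ^ p - Polynomial.C (⟨t ^ p, hL t⟩ : F)) := by
    refine X_pow_sub_C_irreducible_of_prime hp fun b hb => ht ?_
    have h1 : (b : K) ^ p = t ^ p := congrArg Subtype.val hb
    have : (b : K) = t := frobenius_inj K p h1
    rw [← this]; exact b.2
  have hmin : minpoly F t = Polynomial.X ^ p - Polynomial.C (⟨t ^ p, hL t⟩ : F) := by
    refine (minpoly.eq_of_irreducible_of_monic hirr ?_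
      (Polynomial.monic_X_pow_sub_C _ hp.ne_zero)).symm
    simp only [map_sub, map_pow, Polynomial.aeval_X, Polynomial.aeval_C]
    exact sub_self _
  let f : Polynomial F := ∑ j ∈ Finset.range p, Polynomial.monomial j (⟨c j, hc j⟩ : F)
  have hf : Polynomial.aeval t f = 0 := by
    rw [← h, map_sum]
    exact Finset.sum_congr rfl fun j _ => by
      rw [Polynomial.aeval_monomial]; rfl
  have hf0 : f = 0 := by
    by_contra hne
    have h1 := minpoly.degree_le_of_ne_zero F t hne hf
    rw [hmin, Polynomial.degree_X_pow_sub_C hp.pos] at h1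
    refine absurd h1 (not_le.2 ?_)
    refine (Polynomial.degree_sum_le _ _).trans_lt ?_
    rw [Finset.sup_lt_iff (WithBot.bot_lt_coe _)]
    intro j hj
    exact (Polynomial.degree_monomial_le _ _).trans_lt (by exact_mod_cast Finset.mem_range.1 hj)
  intro j hj
  have := congrArg (fun g => ((g.coeff j : F) : K)) hf0
  simpa [f, Polynomial.finsetSum_coeff, Polynomial.coeff_monomial, hj] using this

/-- A set `S` of elements of a field `K` of characteristic `p` with `K = K ^ p[S]` which is
`p`-independent with respect to some linear order of `K`. -/
structure IsOrderedPBasis {K : Type*} [Field K] [LinearOrder K] (p : ℕ) (S : Set K) : Prop where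
  closure_eq_top : Subring.closure (Set.range (· ^ p) ∪ S) = (⊤ : Subring K)
  notMem : ∀ t ∈ S, t ∉ Subring.closure (Set.range (fun x : K => x ^ p) ∪ {s ∈ S | s < t})

/-- Well-order `K` and keep the elements not generated by `p`-th powers and their predecessors;
well-founded induction shows that these generate. -/
theorem exists_isOrderedPBasis (K : Type*) [Field K] (p : ℕ) :
    ∃ (_ : LinearOrder K) (S : Set K), IsOrderedPBasis p S := by
  obtain ⟨o, ho⟩ := exists_wellFoundedLT K
  refine ⟨o, {t | t ∉ Subring.closure (Set.range (fun x : K => x ^ p) ∪ {s | s < t})}, ?_, ?_⟩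
  · rw [eq_top_iff]
    intro c _
    induction c using WellFoundedLT.induction with
    | ind c ih =>
      by_cases hc : c ∈ Subring.closure (Set.range (fun x : K => x ^ p) ∪ {s | s < c})
      · refine (Subring.closure_le.2 ?_ : _ ≤ Subring.closure _) hc
        rintro x (hx | hx)
        · exact Subring.subset_closure (Or.inl hx)
        · exact ih x hx trivial
      · exact Subring.subset_closure (Or.inr hc)
  · intro t ht hmem
    refine ht (Subring.closure_mono ?_ hmem)
    exact Set.union_subset_union_right _ fun s hs => hs.2

variable {A : Type*} [CommRing A]

/-- The subring generated by the `p`-th powers and the `p`-multiples of elements of `D`,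
and by a set `T`. -/
def Subring.frobeniusAdjoin (p : ℕ) (D : Subring A) (T : Set A) : Subring A :=
  Subring.closure ((fun x => x ^ p) '' (D : Set A) ∪ (fun x => (p : A) * x) '' (D : Set A) ∪ T)

namespace Subring

variable {p : ℕ} {D : Subring A}

theorem pow_mem_frobeniusAdjoin {T : Set A} {x : A} (hx : x ∈ D) : x ^ p ∈ frobeniusAdjoin p D T :=
  subset_closure (Or.inl (Or.inl ⟨x, hx, rfl⟩))

theorem mul_mem_frobeniusAdjoin {T : Set A} {x : A} (hx : x ∈ D) :
    (p : A) * x ∈ frobeniusAdjoin p D T :=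
  subset_closure (Or.inl (Or.inr ⟨x, hx, rfl⟩))

theorem subset_frobeniusAdjoin {T : Set A} : T ⊆ frobeniusAdjoin p D T :=
  fun _ hx => subset_closure (Or.inr hx)

theorem frobeniusAdjoin_mono {T T' : Set A} (h : T ⊆ T') :
    frobeniusAdjoin p D T ≤ frobeniusAdjoin p D T' :=
  closure_mono (Set.union_subset_union_right _ h)

theorem frobeniusAdjoin_le {T : Set A} (h : T ⊆ D) : frobeniusAdjoin p D T ≤ D := by
  refine closure_le.2 ?_
  rintro x ((⟨y, hy, rfl⟩ | ⟨y, hy, rfl⟩) | hx)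
  · exact D.pow_mem hy p
  · exact D.mul_mem (natCast_mem D p) hy
  · exact h hx

theorem exists_finset_mem_frobeniusAdjoin {ι : Type*} {S : Set ι} (β : ι → A) {z : A}
    (hz : z ∈ frobeniusAdjoin p D (β '' S)) :
    ∃ T : Finset ι, ↑T ⊆ S ∧ z ∈ frobeniusAdjoin p D (β '' (T : Set ι)) := by
  classical
  induction hz using closure_induction with
  | mem x hx =>
    rcases hx with hx | ⟨s, hs, rfl⟩
    · exact ⟨∅, by simp, subset_closure (Or.inl hx)⟩
    · exact ⟨{s}, by simpa using hs, subset_closure (Or.inr ⟨s, by simp, rfl⟩)⟩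
  | zero => exact ⟨∅, by simp, zero_mem _⟩
  | one => exact ⟨∅, by simp, one_mem _⟩
  | add x y _ _ hx hy =>
    obtain ⟨T, hT, hx⟩ := hx
    obtain ⟨T', hT', hy⟩ := hy
    exact ⟨T ∪ T', by simp [hT, hT'], add_mem
      (frobeniusAdjoin_mono (Set.image_mono (by simp)) hx)
      (frobeniusAdjoin_mono (Set.image_mono (by simp)) hy)⟩
  | neg x _ hx =>
    obtain ⟨T, hT, hx⟩ := hx
    exact ⟨T, hT, neg_mem hx⟩
  | mul x y _ _ hx hy =>
    obtain ⟨T, hT, hx⟩ := hx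
    obtain ⟨T', hT', hy⟩ := hy
    exact ⟨T ∪ T', by simp [hT, hT'], mul_mem
      (frobeniusAdjoin_mono (Set.image_mono (by simp)) hx)
      (frobeniusAdjoin_mono (Set.image_mono (by simp)) hy)⟩

/-- Since `(x + y) ^ p` and `x ^ p + y ^ p` differ by a `p`-multiple, elements of this shape already
form a ring. -/
theorem exists_eq_of_mem_frobeniusAdjoin_empty (hp : p.Prime) {z : A}
    (hz : z ∈ frobeniusAdjoin p D ∅) : ∃ x ∈ D, ∃ y ∈ D, z = x ^ p + p * y := by
  have hadd : ∀ x ∈ D, ∀ y ∈ D, ∃ r ∈ D, (x + y) ^ p = x ^ p + y ^ p + p * r := by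
    intro x hx y hy
    obtain ⟨r, hr⟩ := exists_add_pow_prime_eq hp (⟨x, hx⟩ : D) ⟨y, hy⟩
    refine ⟨_, D.mul_mem (D.mul_mem hx hy) r.2, ?_⟩
    have := congrArg Subtype.val hr
    simp only [Subring.coe_pow, Subring.coe_add, Subring.coe_mul, SubringClass.coe_natCast] at this
    rw [this]; ring
  induction hz using closure_induction with
  | mem x hx =>
    rcases hx with (⟨y, hy, rfl⟩ | ⟨y, hy, rfl⟩) | hx
    · exact ⟨y, hy, 0, zero_mem _, by simp⟩
    · exact ⟨0, zero_mem _, y, hy, by simp [hp.ne_zero]⟩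
    · exact hx.elim
  | zero => exact ⟨0, zero_mem _, 0, zero_mem _, by simp [hp.ne_zero]⟩
  | one => exact ⟨1, one_mem _, 0, zero_mem _, by simp⟩
  | add z w _ _ hz hw =>
    obtain ⟨x, hx, y, hy, rfl⟩ := hz
    obtain ⟨x', hx', y', hy', rfl⟩ := hw
    obtain ⟨r, hr, h⟩ := hadd x hx x' hx'
    exact ⟨x + x', add_mem hx hx', y + y' - r, sub_mem (add_mem hy hy') hr, by rw [h]; ring⟩
  | neg z _ hz =>
    obtain ⟨x, hx, y, hy, rfl⟩ := hz
    obtain ⟨r, hr, h⟩ := hadd x hx (-x) (neg_mem hx)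
    rw [add_neg_cancel, zero_pow hp.ne_zero] at h
    exact ⟨-x, neg_mem hx, r - y, sub_mem hr hy, by linear_combination h⟩
  | mul z w _ _ hz hw =>
    obtain ⟨x, hx, y, hy, rfl⟩ := hz
    obtain ⟨x', hx', y', hy', rfl⟩ := hw
    refine ⟨x * x', mul_mem hx hx', x ^ p * y' + y * x' ^ p + p * (y * y'), ?_, by ring⟩
    exact add_mem (add_mem (mul_mem (pow_mem hx _) hy') (mul_mem hy (pow_mem hx' _)))
      (mul_mem (natCast_mem _ _) (mul_mem hy hy'))

/-- As `b ^ p` already lies in the smaller ring, division by the monic polynomial `X ^ p - b ^ p`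
brings any polynomial in `b` to degree below `p`. -/
theorem exists_eq_sum_of_mem_frobeniusAdjoin_insert (hp : p.Prime) {T : Set A} {b z : A}
    (hb : b ∈ D) (hz : z ∈ frobeniusAdjoin p D (insert b T)) :
    ∃ d : ℕ → A, (∀ j, d j ∈ frobeniusAdjoin p D T) ∧ z = ∑ j ∈ Finset.range p, d j * b ^ j := by
  nontriviality A
  set E := frobeniusAdjoin p D T
  have hle : frobeniusAdjoin p D (insert b T) ≤ (Polynomial.aeval (R := E) b).toRingHom.range := by
    refine closure_le.2 ?_
    have hE : ∀ x ∈ E, x ∈ (Polynomial.aeval (R := E) b).toRingHom.range := fun x hx =>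
      ⟨Polynomial.C ⟨x, hx⟩, by simp; rfl⟩
    rintro x (hx | rfl | hx)
    · exact hE x (subset_closure (Or.inl hx))
    · exact ⟨Polynomial.X, by simp⟩
    · exact hE x (subset_frobeniusAdjoin hx)
  obtain ⟨f, rfl⟩ := hle hz
  let g : Polynomial E := Polynomial.X ^ p - Polynomial.C ⟨b ^ p, pow_mem_frobeniusAdjoin hb⟩
  have hg : g.Monic := Polynomial.monic_X_pow_sub_C _ hp.ne_zero
  have hgb : Polynomial.aeval b g = 0 := by
    simp only [g, map_sub, map_pow, Polynomial.aeval_X, Polynomial.aeval_C]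
    exact sub_self _
  refine ⟨fun j => ((f %ₘ g).coeff j : E), fun j => ((f %ₘ g).coeff j).2, ?_⟩
  have h1 : Polynomial.aeval b f = Polynomial.aeval b (f %ₘ g) := by
    conv_lhs => rw [← Polynomial.modByMonic_add_div f g]
    simp [hgb]
  change Polynomial.aeval b f = _
  rw [h1, Polynomial.aeval_eq_sum_range' (n := p)]
  · rfl
  · have := Polynomial.natDegree_modByMonic_lt f hg (by
      intro h
      have := congrArg Polynomial.natDegree h
      rw [Polynomial.natDegree_X_pow_sub_C, Polynomial.natDegree_one] at this
      exact hp.ne_zero this)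
    rwa [Polynomial.natDegree_X_pow_sub_C] at this

end Subring

end CoefficientRing

/-! ### The Frobenius tower over a subfield of the quotient -/

section CoefficientRing

open Subring

variable {A : Type*} [CommRing A] {J : Ideal A} {p : ℕ} {K : Type*} [Field K]

theorem exists_mem_closure_of_mem_frobeniusAdjoin (σ : K →+* A ⧸ J) (β : K → A)
    (hβ : ∀ c, Ideal.Quotient.mk J (β c) = σ c) (hpJ : (p : A) ∈ J) {D : Subring A}
    (hD : ∀ x ∈ D, ∃ c, Ideal.Quotient.mk J x = σ c) {T : Set K} {z : A}
    (hz : z ∈ frobeniusAdjoin p D (β '' T)) :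
    ∃ c ∈ Subring.closure (Set.range (fun x : K => x ^ p) ∪ T), Ideal.Quotient.mk J z = σ c := by
  have hle : frobeniusAdjoin p D (β '' T) ≤
      ((Subring.closure (Set.range (fun x : K => x ^ p) ∪ T)).map σ).comap
        (Ideal.Quotient.mk J) := by
    refine closure_le.2 ?_
    rintro x ((⟨y, hy, rfl⟩ | ⟨y, hy, rfl⟩) | ⟨t, ht, rfl⟩)
    · obtain ⟨c, hc⟩ := hD y hy
      exact ⟨c ^ p, subset_closure (Or.inl ⟨c, rfl⟩), by simp [hc]⟩
    · refine ⟨0, Subring.zero_mem _, ?_⟩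
      rw [map_zero, map_mul, Ideal.Quotient.eq_zero_iff_mem.2 hpJ, zero_mul]
    · exact ⟨t, subset_closure (Or.inr ht), (hβ t).symm⟩
  obtain ⟨c, hc, h⟩ := hle hz
  exact ⟨c, hc, h.symm⟩

/-- Induction on the finite set of basis elements involved, removing the largest one `t`. Expand `z`
in powers of `β t` below `p`: modulo `J` this is a relation for `t` over the field generated by the
`p`-th powers and smaller basis elements, so all coefficients lie in `J` and induction applies. With
no basis element left, `z = x ^ p + p * y` with `x ∈ J`, and the two hypotheses on `Q` finish. -/
theorem mem_of_mem_frobeniusAdjoin_of_mem [LinearOrder K] [CharP K p] (hp : p.Prime)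
    (σ : K →+* A ⧸ J) (hJ : J ≠ ⊤) (hpJ : (p : A) ∈ J)
    (β : K → A) (hβ : ∀ c, Ideal.Quotient.mk J (β c) = σ c) {S : Set K}
    (hS : IsOrderedPBasis p S) {D : Subring A} (hD : ∀ x ∈ D, ∃ c, Ideal.Quotient.mk J x = σ c)
    (hβD : ∀ s ∈ S, β s ∈ D) (Q : AddSubgroup A) (hβQ : ∀ s ∈ S, ∀ q ∈ Q, q * β s ∈ Q)
    (hpow : ∀ x ∈ D, x ∈ J → x ^ p ∈ Q) (hmul : ∀ y ∈ D, (p : A) * y ∈ Q)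
    {z : A} (hz : z ∈ frobeniusAdjoin p D (β '' S)) (hzJ : z ∈ J) : z ∈ Q := by
  have hσ : Function.Injective σ := by
    have := Ideal.Quotient.nontrivial_iff.2 hJ
    exact σ.injective
  obtain ⟨T, hTS, hzT⟩ := exists_finset_mem_frobeniusAdjoin β hz
  clear hz
  induction T using Finset.induction_on_max generalizing z with
  | empty =>
    rw [Finset.coe_empty, Set.image_empty] at hzT
    obtain ⟨x, hx, y, hy, rfl⟩ := exists_eq_of_mem_frobeniusAdjoin_empty hp hzT
    refine Q.add_mem (hpow x hx ?_) (hmul y hy)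
    have h1 : x ^ p ∈ J := (Ideal.add_mem_iff_left J (J.mul_mem_right _ hpJ)).1 hzJ
    obtain ⟨c, hc⟩ := hD x hx
    have h2 : σ (c ^ p) = 0 := by
      rw [map_pow, ← hc, ← map_pow]
      exact Ideal.Quotient.eq_zero_iff_mem.2 h1
    have h3 : c = 0 := pow_eq_zero_iff hp.ne_zero |>.1 ((map_eq_zero_iff σ hσ).1 h2)
    rw [h3, map_zero] at hc
    exact Ideal.Quotient.eq_zero_iff_mem.1 hc
  | insert t T hlt ih =>
    rw [Finset.coe_insert, Set.image_insert_eq] at hzT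
    have htS : t ∈ S := hTS (by simp)
    have hTS' : (T : Set K) ⊆ S := fun x hx => hTS (by simp [Finset.mem_coe.1 hx])
    obtain ⟨d, hd, rfl⟩ := exists_eq_sum_of_mem_frobeniusAdjoin_insert hp (hβD t htS) hzT
    choose c hc hdc using fun j => exists_mem_closure_of_mem_frobeniusAdjoin σ β hβ hpJ hD (hd j)
    have hsum : ∑ j ∈ Finset.range p, c j * t ^ j = 0 := by
      apply hσ
      rw [map_zero, ← Ideal.Quotient.eq_zero_iff_mem.2 hzJ, map_sum, map_sum]
      exact Finset.sum_congr rfl fun j _ => by rw [map_mul, map_mul, map_pow, map_pow, hβ, hdc]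
    have hle : Subring.closure (Set.range (fun x : K => x ^ p) ∪ T) ≤
        Subring.closure (Set.range (fun x : K => x ^ p) ∪ {s ∈ S | s < t}) :=
      Subring.closure_mono (Set.union_subset_union_right _ fun x hx => ⟨hTS' hx, hlt x hx⟩)
    have hc0 := Subring.eq_zero_of_sum_pow_eq_zero hp
      (Subring.closure (Set.range (fun x : K => x ^ p) ∪ {s ∈ S | s < t}))
      (fun x => Subring.subset_closure (Or.inl ⟨x, rfl⟩)) (hS.notMem t htS) c (fun j => hle (hc j)) hsum
    refine Q.sum_mem fun j hj => ?_
    have hdQ : d j ∈ Q := by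
      refine ih ?_ hTS' (hd j)
      have := hdc j
      rw [hc0 j (Finset.mem_range.1 hj), map_zero] at this
      exact Ideal.Quotient.eq_zero_iff_mem.1 this
    have (i : ℕ) : d j * β t ^ i ∈ Q := by
      induction i with
      | zero => simpa using hdQ
      | succ i ihi => rw [pow_succ, ← mul_assoc]; exact hβQ t htS _ ihi
    exact this j

/-- The decreasing sequence of subrings of `A` obtained from `D` by iterating
`Subring.frobeniusAdjoin`. -/
def Subring.frobeniusTower (p : ℕ) (D : Subring A) (T : Set A) : ℕ → Subring A
  | 0 => D
  | n + 1 => frobeniusAdjoin p (frobeniusTower p D T n) T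

/-- Raising to the `p`-th power improves a congruence by one order, as `p ∈ I` and `(n + 1) * p ≥ n
+ 2`. This gain drives the tower. -/
theorem add_pow_sub_pow_mem {R : Type*} [CommRing R] (I : Ideal R) {p : ℕ} (hp : p.Prime)
    (hpI : (p : R) ∈ I) (n : ℕ) (x a : R) (ha : a ∈ I ^ (n + 1)) :
    (x + a) ^ p - x ^ p ∈ I ^ (n + 2) := by
  obtain ⟨r, hr⟩ := exists_add_pow_prime_eq hp x a
  have : (x + a) ^ p - x ^ p = a ^ p + p * a * (x * r) := by rw [hr]; ring
  rw [this]
  refine add_mem ?_ (Ideal.mul_mem_right _ _ ?_)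
  · have h1 : a ^ p ∈ (I ^ (n + 1)) ^ p := Ideal.pow_mem_pow ha p
    rw [← pow_mul] at h1
    refine Ideal.pow_le_pow_right ?_ h1
    nlinarith [hp.two_le]
  · rw [show n + 2 = 1 + (n + 1) by ring, pow_add, pow_one]
    exact Ideal.mul_mem_mul hpI ha

section Tower

variable (hp : p.Prime) (σ : K →+* A ⧸ J) (hJ : J ≠ ⊤) (hpJ : (p : A) ∈ J)
    (β : K → A) (hβ : ∀ c, Ideal.Quotient.mk J (β c) = σ c) {S : Set K} {D : Subring A}
    (hD : ∀ x, x ∈ D ↔ ∃ c, Ideal.Quotient.mk J x = σ c)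

include hβ hD in
theorem Subring.frobeniusTower_succ_le (n : ℕ) :
    frobeniusTower p D (β '' S) (n + 1) ≤ frobeniusTower p D (β '' S) n ∧
      β '' S ⊆ frobeniusTower p D (β '' S) n := by
  have h : β '' S ⊆ frobeniusTower p D (β '' S) n := by
    cases n with
    | zero =>
      rintro _ ⟨s, -, rfl⟩
      exact (hD _).2 ⟨s, hβ s⟩
    | succ n => exact subset_frobeniusAdjoin
  exact ⟨frobeniusAdjoin_le h, h⟩

include hβ hD in
theorem Subring.frobeniusTower_le (n : ℕ) : frobeniusTower p D (β '' S) n ≤ D :=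
  antitone_nat_of_succ_le (f := frobeniusTower p D (β '' S))
    (fun n => (frobeniusTower_succ_le σ β hβ hD n).1) (Nat.zero_le n)

include hβ hD in
theorem Subring.exists_mem_frobeniusTower [LinearOrder K] (hS : IsOrderedPBasis p S) (n : ℕ) (c : K) :
    ∃ x ∈ frobeniusTower p D (β '' S) n, Ideal.Quotient.mk J x = σ c := by
  induction n generalizing c with
  | zero => exact ⟨β c, (hD _).2 ⟨c, hβ c⟩, hβ c⟩
  | succ n ih =>
    have hle : Subring.closure (Set.range (fun x : K => x ^ p) ∪ S) ≤
        ((frobeniusTower p D (β '' S) (n + 1)).map (Ideal.Quotient.mk J)).comap σ := by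
      refine closure_le.2 ?_
      rintro x (⟨y, rfl⟩ | hx)
      · obtain ⟨z, hz, h⟩ := ih y
        exact ⟨z ^ p, pow_mem_frobeniusAdjoin hz, by simp [h]⟩
      · exact ⟨β x, subset_frobeniusAdjoin ⟨x, hx, rfl⟩, hβ x⟩
    exact hle (hS.closure_eq_top ▸ Subring.mem_top c)

-- The two halves feed each other. The first says that modulo `J ^ (n + 1)` only `p`-multiples
-- remain in the kernel of reduction; it yields the second by correcting an element of the next
-- stage with the same residue. Both at level `n` give the first at level `n + 1`.
include hp hJ hpJ hβ hD in
theorem Subring.frobeniusTower_spec [LinearOrder K] [CharP K p] (hS : IsOrderedPBasis p S) (n : ℕ) :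
    (∀ z ∈ frobeniusTower p D (β '' S) n, z ∈ J →
      ∃ d ∈ frobeniusTower p D (β '' S) n, z - p * d ∈ J ^ (n + 1)) ∧
    (∀ y ∈ frobeniusTower p D (β '' S) n,
      ∃ d ∈ frobeniusTower p D (β '' S) (n + 1), y - d ∈ J ^ (n + 1) ) := by
  have key : ∀ n, (∀ z ∈ frobeniusTower p D (β '' S) n, z ∈ J →
      ∃ d ∈ frobeniusTower p D (β '' S) n, z - p * d ∈ J ^ (n + 1)) →
    (∀ y ∈ frobeniusTower p D (β '' S) n,
      ∃ d ∈ frobeniusTower p D (β '' S) (n + 1), y - d ∈ J ^ (n + 1)) := by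
    intro n h y hy
    obtain ⟨c, hc⟩ := (hD y).1 (frobeniusTower_le σ β hβ hD n hy)
    obtain ⟨x, hx, hxc⟩ := exists_mem_frobeniusTower σ β hβ hD hS (n + 1) c
    obtain ⟨d, hd, hyd⟩ := h (y - x)
      (sub_mem hy ((frobeniusTower_succ_le σ β hβ hD n).1 hx))
      (Ideal.Quotient.eq_zero_iff_mem.1 (by rw [map_sub, hc, hxc, sub_self]))
    exact ⟨x + p * d, add_mem hx (mul_mem_frobeniusAdjoin hd), by rwa [← sub_sub]⟩
  suffices h : ∀ n, (∀ z ∈ frobeniusTower p D (β '' S) n, z ∈ J →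
      ∃ d ∈ frobeniusTower p D (β '' S) n, z - p * d ∈ J ^ (n + 1)) from ⟨h n, key n (h n)⟩
  intro n
  induction n with
  | zero => exact fun z _ hz => ⟨0, zero_mem _, by simpa using hz⟩
  | succ n ih =>
    intro z hz hzJ
    -- The desired conclusion at level `n + 1`, packaged as a group so that the reduction along the
    -- `p`-basis applies.
    let Q : AddSubgroup A :=
      { carrier := {z | ∃ d ∈ frobeniusTower p D (β '' S) (n + 1), z - p * d ∈ J ^ (n + 2)}
        zero_mem' := ⟨0, zero_mem _, by simp⟩
        add_mem' := by
          rintro a b ⟨d, hd, h⟩ ⟨d', hd', h'⟩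
          refine ⟨d + d', add_mem hd hd', ?_⟩
          have := add_mem h h'
          convert this using 1
          ring
        neg_mem' := by
          rintro a ⟨d, hd, h⟩
          refine ⟨-d, neg_mem hd, ?_⟩
          have := neg_mem h
          convert this using 1
          ring }
    refine mem_of_mem_frobeniusAdjoin_of_mem hp σ hJ hpJ β hβ hS
      (fun x hx => (hD x).1 (frobeniusTower_le σ β hβ hD n hx))
      (fun s hs => (frobeniusTower_succ_le σ β hβ hD n).2 ⟨s, hs, rfl⟩) Q ?_ ?_ ?_ hz hzJ
    · rintro s hs q ⟨d, hd, h⟩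
      refine ⟨d * β s, mul_mem hd (subset_frobeniusAdjoin ⟨s, hs, rfl⟩), ?_⟩
      have := Ideal.mul_mem_right (β s) _ h
      convert this using 1
      ring
    · intro x hx hxJ
      obtain ⟨d, hd, h⟩ := ih x hx hxJ
      -- From `x ≡ p * d` one gets `x ^ p ≡ p * (p ^ (p - 1) * d ^ p)` one order higher, and `d ^ p`
      -- belongs to the next stage.
      refine ⟨p ^ (p - 1) * d ^ p, mul_mem (pow_mem (natCast_mem _ _) _)
        (pow_mem_frobeniusAdjoin hd), ?_⟩
      have := add_pow_sub_pow_mem J hp hpJ n (p * d) _ h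
      convert this using 1
      rw [← mul_assoc, mul_pow]
      congr 2
      · ring
      · rw [← pow_succ', Nat.sub_add_cancel hp.one_le]
    · intro y hy
      obtain ⟨d, hd, h⟩ := key n ih y hy
      refine ⟨d, hd, ?_⟩
      rw [← mul_sub, show n + 2 = 1 + (n + 1) by ring, pow_add, pow_one]
      exact Ideal.mul_mem_mul hpJ h

end Tower

end CoefficientRing

/-! ### Passage to the limit of the tower -/

section CoefficientRing

open Subring

theorem IsPrecomplete.exists_forall_sub_mem_pow {A : Type*} [CommRing A] (J : Ideal A)
    [IsPrecomplete J A] (f : ℕ → A) (hf : ∀ n, f n - f (n + 1) ∈ J ^ n) :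
    ∃ L, ∀ n, f n - L ∈ J ^ n := by
  have hf' : ∀ {m n}, m ≤ n → f m - f n ∈ J ^ m := by
    intro m n hmn
    induction n, hmn using Nat.le_induction with
    | base => simp
    | succ n hmn ih =>
      have := add_mem ih (Ideal.pow_le_pow_right hmn (hf n))
      simpa using this
  obtain ⟨L, hL⟩ := IsPrecomplete.prec (I := J) (M := A) inferInstance (f := f) (by
    intro m n hmn
    rw [SModEq.sub_mem, smul_eq_mul, Ideal.mul_top]
    exact hf' hmn)
  refine ⟨L, fun n => ?_⟩
  have := hL n
  rwa [SModEq.sub_mem, smul_eq_mul, Ideal.mul_top] at this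

/-- Let `A` be `J`-adically complete with `p ∈ J`, and let `K` be a field of characteristic `p`
inside `A ⧸ J`. Then there is a closed subring `C` of `A` which maps onto `K`, such that
`C ∩ J` is the closure of `p C`. -/
theorem exists_coefficient_subring {A : Type*} [CommRing A] (J : Ideal A) [IsAdicComplete J A]
    {p : ℕ} (hp : p.Prime) {K : Type*} [Field K] [CharP K p] (σ : K →+* A ⧸ J) (hJ : J ≠ ⊤)
    (hpJ : (p : A) ∈ J) :
    ∃ C : Subring A, (∀ x ∈ C, ∃ c, Ideal.Quotient.mk J x = σ c) ∧
      (∀ c, ∃ x ∈ C, Ideal.Quotient.mk J x = σ c) ∧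
      (∀ z ∈ C, z ∈ J → ∀ n, ∃ d ∈ C, z - p * d ∈ J ^ n) ∧
      (∀ x, (∀ n, ∃ c ∈ C, x - c ∈ J ^ n) → x ∈ C) := by
  obtain ⟨o, S, hS⟩ := exists_isOrderedPBasis K p
  choose β hβ using fun c => Ideal.Quotient.mk_surjective (I := J) (σ c)
  let D₀ : Subring A := σ.range.comap (Ideal.Quotient.mk J)
  have hD : ∀ x, x ∈ D₀ ↔ ∃ c, Ideal.Quotient.mk J x = σ c :=
    fun x => ⟨fun ⟨c, h⟩ => ⟨c, h.symm⟩, fun ⟨c, h⟩ => ⟨c, h.symm⟩⟩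
  let D := frobeniusTower p D₀ (β '' S)
  have hanti : Antitone D := antitone_nat_of_succ_le
    fun n => (frobeniusTower_succ_le σ β hβ hD n).1
  have hspec := frobeniusTower_spec hp σ hJ hpJ β hβ hD hS
  let C : Subring A :=
    ⨅ n, ((D n).map (Ideal.Quotient.mk (J ^ (n + 1)))).comap (Ideal.Quotient.mk (J ^ (n + 1)))
  have hC : ∀ x, x ∈ C ↔ ∀ n, ∃ d ∈ D n, x - d ∈ J ^ (n + 1) := by
    intro x
    simp only [C, Subring.mem_iInf, Subring.mem_comap, Subring.mem_map]
    refine forall_congr' fun n => exists_congr fun d => and_congr_right fun _ => ?_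
    rw [eq_comm, Ideal.Quotient.eq]
  have hlift : ∀ n, ∀ y ∈ D n, ∃ x ∈ C, x - y ∈ J ^ (n + 1) := by
    intro n y hy
    choose! g hg hg' using fun n => (hspec n).2
    -- Starting from `y`, move one stage down the tower at a time; the corrections tend to zero, so
    -- the sequence converges to an element of `C`.
    let c : ℕ → A := fun i => Nat.rec y (fun i ci => g (n + i) ci) i
    have hc : ∀ i, c i ∈ D (n + i) := by
      intro i
      induction i with
      | zero => exact hy
      | succ i ih => exact hg (n + i) _ ih
    have hcc : ∀ i, c i - c (i + 1) ∈ J ^ (n + i + 1) := fun i => hg' (n + i) _ (hc i)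
    obtain ⟨L, hL⟩ := IsPrecomplete.exists_forall_sub_mem_pow J c
      fun i => Ideal.pow_le_pow_right (by lia) (hcc i)
    refine ⟨L, (hC L).2 fun m => ⟨c (m + 1), hanti (by lia) (hc (m + 1)), ?_⟩, ?_⟩
    · rw [← neg_sub]; exact neg_mem (hL _)
    · have h0 : ∀ i, y - c i ∈ J ^ (n + 1) := by
        intro i
        induction i with
        | zero => simp [c]
        | succ i ih =>
          have := add_mem ih (Ideal.pow_le_pow_right (by lia) (hcc i))
          simpa using this
      have := neg_mem (add_mem (h0 (n + 1)) (hL (n + 1)))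
      simpa using this
  refine ⟨C, fun x hx => ?_, fun c => ?_, fun z hz hzJ n => ?_, fun x hx => ?_⟩
  · obtain ⟨d, hd, h⟩ := (hC x).1 hx 0
    obtain ⟨c, hc⟩ := (hD d).1 hd
    refine ⟨c, hc ▸ Ideal.Quotient.eq.2 (by simpa using h)⟩
  · obtain ⟨x, hx, h⟩ := hlift 0 (β c) ((hD _).2 ⟨c, hβ c⟩)
    exact ⟨x, hx, hβ c ▸ Ideal.Quotient.eq.2 (by simpa using h)⟩
  · obtain ⟨u, hu, h⟩ := (hC z).1 hz n
    have huJ : u ∈ J := by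
      have := sub_mem hzJ (Ideal.pow_le_self (by lia) h)
      simpa using this
    obtain ⟨v, hv, h'⟩ := (hspec n).1 u hu huJ
    obtain ⟨d, hd, h''⟩ := hlift n v hv
    refine ⟨d, hd, Ideal.pow_le_pow_right (Nat.le_succ n) ?_⟩
    have := sub_mem (add_mem h h') (Ideal.mul_mem_left _ (p : A) h'')
    convert this using 1
    ring
  · refine (hC x).2 fun n => ?_
    obtain ⟨c, hc, h⟩ := hx (n + 1)
    obtain ⟨d, hd, h'⟩ := (hC c).1 hc n
    refine ⟨d, hd, ?_⟩
    have := add_mem h h'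
    simpa using this

end CoefficientRing

/-! ### Coefficient fields and coefficient rings of complete local rings -/

section CoefficientRing

open IsLocalRing

theorem IsPrecomplete.of_surjective_ringHom {A B : Type*} [CommRing A] [CommRing B] (I : Ideal A)
    [IsPrecomplete I A] (f : A →+* B) (hf : Function.Surjective f) :
    IsPrecomplete (I.map f) B := by
  refine ⟨fun s hs => ?_⟩
  have hs' : ∀ n, ∃ a ∈ I ^ n, f a = s (n + 1) - s n := fun n => by
    have h := (hs (Nat.le_succ n)).symm
    rw [SModEq.sub_mem, smul_eq_mul, Ideal.mul_top, ← Ideal.map_pow,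
      Ideal.mem_map_iff_of_surjective f hf] at h
    exact h
  choose a ha hfa using hs'
  obtain ⟨t, ht⟩ := hf (s 0)
  let g : ℕ → A := fun n => t + ∑ i ∈ Finset.range n, a i
  have hg : ∀ n, f (g n) = s n := by
    intro n
    induction n with
    | zero => simp [g, ht]
    | succ n ih =>
      have : g (n + 1) = g n + a n := by simp [g, Finset.sum_range_succ, add_assoc]
      rw [this, map_add, ih, hfa]; ring
  obtain ⟨L, hL⟩ := IsPrecomplete.exists_forall_sub_mem_pow I g fun n => by
    have : g n - g (n + 1) = -a n := by simp [g, Finset.sum_range_succ]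
    rw [this]
    exact neg_mem (ha n)
  refine ⟨f L, fun n => ?_⟩
  rw [SModEq.sub_mem, smul_eq_mul, Ideal.mul_top, ← hg, ← map_sub, ← Ideal.map_pow]
  exact Ideal.mem_map_of_mem f (hL n)

variable (A : Type u) [CommRing A] [IsLocalRing A] [IsNoetherianRing A]
  [IsAdicComplete (maximalIdeal A) A]

theorem IsLocalRing.isAdicComplete_quotient (I : Ideal A) [IsLocalRing (A ⧸ I)] :
    IsAdicComplete (maximalIdeal (A ⧸ I)) (A ⧸ I) := by
  have h : (maximalIdeal A).map (Ideal.Quotient.mk I) = maximalIdeal (A ⧸ I) :=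
    IsLocalRing.map_maximalIdeal_of_surjective _ Ideal.Quotient.mk_surjective
  have := IsPrecomplete.of_surjective_ringHom (maximalIdeal A) (Ideal.Quotient.mk I)
    Ideal.Quotient.mk_surjective
  rw [h] at this
  exact { }

/-- An `I`-adic Cauchy sequence has a limit for the maximal ideal. It is also an `I`-adic limit,
because each `I ^ n` is closed: `A ⧸ I ^ n` is separated for the maximal-adic topology. -/
theorem IsLocalRing.isAdicComplete_of_ne_top (I : Ideal A) (hI : I ≠ ⊤) : IsAdicComplete I A := by
  have hIm : I ≤ maximalIdeal A := le_maximalIdeal hI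
  have : IsHausdorff I A := IsHausdorff.of_isLocalRing I A hI
  have : IsPrecomplete I A := by
    refine ⟨fun s hs => ?_⟩
    obtain ⟨L, hL⟩ := IsPrecomplete.exists_forall_sub_mem_pow (maximalIdeal A) s fun n => by
      have h := hs (Nat.le_succ n)
      rw [SModEq.sub_mem, smul_eq_mul, Ideal.mul_top] at h
      exact Ideal.pow_right_mono hIm n h
    refine ⟨L, fun n => ?_⟩
    rw [SModEq.sub_mem, smul_eq_mul, Ideal.mul_top, ← Ideal.Quotient.eq]
    rw [IsHausdorff.eq_iff_smodEq (I := maximalIdeal A)]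
    intro k
    have h1 : s n - s (n + k) ∈ I ^ n := by
      have h := hs (Nat.le_add_right n k)
      rwa [SModEq.sub_mem, smul_eq_mul, Ideal.mul_top] at h
    have h2 : s (n + k) - L ∈ maximalIdeal A ^ k := Ideal.pow_le_pow_right (by lia) (hL (n + k))
    rw [Ideal.Quotient.eq.2 h1, SModEq.sub_mem, ← map_sub]
    have := Submodule.smul_mem_smul (N := (⊤ : Submodule A (A ⧸ I ^ n))) h2
      (Submodule.mem_top (x := 1))
    rwa [Algebra.smul_def, mul_one] at this
  exact { }

/-- A complete noetherian local ring of characteristic `p` has a coefficient field. -/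
theorem exists_coefficientField_of_natCast_eq_zero {p : ℕ} (hp : p.Prime) (hpA : (p : A) = 0) :
    ∃ (K : Type u) (_ : Field K) (φ : K →+* A), Function.Surjective ((residue A).comp φ) := by
  have : CharP (ResidueField A) p := by
    have := Fact.mk hp
    exact (CharP.charP_iff_prime_eq_zero hp).2 (by rw [← map_natCast (residue A), hpA, map_zero])
  obtain ⟨C, -, h1, h2, -⟩ := exists_coefficient_subring (maximalIdeal A) hp
    (K := ResidueField A) (RingHom.id _) (maximalIdeal.isMaximal A).ne_top (hpA ▸ zero_mem _)
  have h3 : ∀ z ∈ C, z ∈ maximalIdeal A → z = 0 := by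
    intro z hz hzm
    rw [IsHausdorff.eq_iff_smodEq (I := maximalIdeal A)]
    intro n
    obtain ⟨d, -, hd⟩ := h2 z hz hzm n
    rw [SModEq.sub_mem, smul_eq_mul, Ideal.mul_top, sub_zero]
    simpa [hpA] using hd
  have hC : IsField C := by
    refine ⟨⟨0, 1, zero_ne_one⟩, mul_comm, fun {x} hx => ?_⟩
    have hxm : (x : A) ∉ maximalIdeal A := fun h => hx (Subtype.ext (h3 x x.2 h))
    obtain ⟨y, hy, hxy⟩ := h1 (residue A x)⁻¹
    refine ⟨⟨y, hy⟩, Subtype.ext ?_⟩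
    refine sub_eq_zero.1 (h3 (x * y - 1) (sub_mem (mul_mem x.2 hy) (one_mem _)) ?_)
    have hxy' : residue A y = (residue A x)⁻¹ := hxy
    rw [← residue_eq_zero_iff, map_sub, map_mul, hxy', map_one, mul_inv_cancel₀, sub_self]
    rwa [Ne, residue_eq_zero_iff]
  refine ⟨C, hC.toField, C.subtype, fun c => ?_⟩
  obtain ⟨x, hx, hc⟩ := h1 c
  exact ⟨⟨x, hx⟩, hc⟩

theorem Algebra.FormallySmooth.of_field_charZero (F L : Type*) [Field F] [CharZero F] [Field L]
    [Algebra F L] : Algebra.FormallySmooth F L := by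
  obtain ⟨s, hs⟩ := exists_isTranscendenceBasis F L
  have halg : Algebra.IsAlgebraic (Algebra.adjoin F (Set.range ((↑) : s → L))) L := hs.isAlgebraic
  have : Algebra.IsAlgebraic (IntermediateField.adjoin F (Set.range ((↑) : s → L))) L :=
    hs.isAlgebraic_field
  exact .of_algebraicIndependent_of_isSeparable hs.1

omit [IsNoetherianRing A] in
/-- A complete noetherian local ring of residue characteristic zero has a coefficient field. -/
theorem exists_coefficientField_of_charZero [CharZero (ResidueField A)] :
    ∃ (K : Type u) (_ : Field K) (φ : K →+* A), Function.Surjective ((residue A).comp φ) := by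
  have hu : ∀ n : ℤ, n ≠ 0 → IsUnit (n : A) := by
    intro n hn
    rw [← notMem_maximalIdeal, ← residue_eq_zero_iff, map_intCast]
    exact_mod_cast hn
  let _ : Algebra ℚ A := (IsLocalization.lift (M := nonZeroDivisors ℤ) (S := ℚ)
    (g := Int.castRingHom A) fun y => hu y (nonZeroDivisors.ne_zero y.2)).toAlgebra
  have := Algebra.FormallySmooth.of_field_charZero ℚ (ResidueField A)
  obtain ⟨g, hg⟩ := Algebra.FormallySmooth.exists_mkₐ_comp_eq_of_isAdicComplete
    (R := ℚ) (A := ResidueField A) (S := A) (I := maximalIdeal A) (RingHom.toRatAlgHom (RingHom.id (ResidueField A)))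
  exact ⟨ResidueField A, inferInstance, g.toRingHom, fun c => ⟨c, DFunLike.congr_fun hg c⟩⟩

/-- Take `J = (p)` and a coefficient field of `A ⧸ p`. The resulting subring `C` has `C ∩ J = p C`,
and elements outside `J` are units, so `C` is a discrete valuation ring with uniformizer `p`. -/
theorem exists_coefficientRing_of_natCast_ne_zero [IsDomain A] {p : ℕ} (hp : p.Prime)
    (hp0 : (p : A) ≠ 0) (hpm : (p : A) ∈ maximalIdeal A) :
    ∃ (C : Type u) (_ : CommRing C) (_ : IsDomain C) (_ : IsLocalRing C)
      (_ : IsPrincipalIdealRing C) (φ : C →+* A), Function.Surjective ((residue A).comp φ) := by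
  set J : Ideal A := Ideal.span {(p : A)} with hJdef
  have hpJ : (p : A) ∈ J := Ideal.mem_span_singleton_self _
  have hJm : J ≤ maximalIdeal A := by rwa [hJdef, Ideal.span_singleton_le_iff_mem]
  have hJ : J ≠ ⊤ := fun h => (maximalIdeal.isMaximal A).ne_top (top_le_iff.1 (h ▸ hJm))
  have : Nontrivial (A ⧸ J) := Ideal.Quotient.nontrivial_iff.2 hJ
  have : IsLocalRing (A ⧸ J) := .of_surjective' _ Ideal.Quotient.mk_surjective
  have := IsLocalRing.isAdicComplete_quotient A J
  obtain ⟨K, _, σ, hσ⟩ := exists_coefficientField_of_natCast_eq_zero (A ⧸ J) hp (by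
    rw [← map_natCast (Ideal.Quotient.mk J), Ideal.Quotient.eq_zero_iff_mem.2 hpJ])
  have : CharP K p := by
    refine (CharP.charP_iff_prime_eq_zero hp).2 (σ.injective ?_)
    rw [map_natCast, ← map_natCast (Ideal.Quotient.mk J), Ideal.Quotient.eq_zero_iff_mem.2 hpJ,
      map_zero]
  have := IsLocalRing.isAdicComplete_of_ne_top A J hJ
  obtain ⟨C, h0, h1, h2, h3⟩ := exists_coefficient_subring J hp σ hJ hpJ
  have hmul : ∀ n, ∀ z, z ∈ J ^ n ↔ (p : A) ^ n ∣ z := fun n z => by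
    rw [hJdef, Ideal.span_singleton_pow, Ideal.mem_span_singleton]
  have hdiv : ∀ z ∈ C, z ∈ J → ∃ d ∈ C, z = p * d := by
    intro z hz hzJ
    obtain ⟨d, rfl⟩ := Ideal.mem_span_singleton.1 hzJ
    refine ⟨d, h3 d fun n => ?_, rfl⟩
    obtain ⟨d', hd', h⟩ := h2 _ hz hzJ (n + 1)
    refine ⟨d', hd', ?_⟩
    -- Cancelling `p` in the domain `A` costs one power, hence the approximation to order `n + 1`;
    -- then `d ∈ C` because `C` is closed.
    rw [← mul_sub, hmul, pow_succ', mul_dvd_mul_iff_left hp0, ← hmul] at h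
    exact h
  have hunit : ∀ x : C, (x : A) ∉ J → IsUnit x := by
    intro x hx
    obtain ⟨c, hc⟩ := h0 x x.2
    have hc0 : c ≠ 0 := by
      rintro rfl
      exact hx (Ideal.Quotient.eq_zero_iff_mem.1 (by rw [hc, map_zero]))
    obtain ⟨y, hy, hyc⟩ := h1 c⁻¹
    have hw : 1 - x * y ∈ J := by
      rw [← Ideal.Quotient.eq_zero_iff_mem, map_sub, map_mul, hc, hyc, ← map_mul,
        mul_inv_cancel₀ hc0, map_one, map_one, sub_self]
    have hxy : IsUnit ((x : A) * y) := by
      by_contra h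
      exact one_notMem_nonunits (α := A)
        (show (1 : A) ∈ maximalIdeal A by
          simpa using add_mem (hJm hw) ((mem_maximalIdeal _).2 h))
    obtain ⟨v, hv⟩ := hxy.exists_right_inv
    have hxv : (x : A) * (y * v) = 1 := by rw [← mul_assoc, hv]
    have hmem : y * v ∈ C := by
      -- The inverse is approximated inside `C` by partial sums of the geometric series for `1 / (1
      -- - (1 - x * y))`.
      refine h3 _ fun n => ⟨y * ∑ i ∈ Finset.range n, (1 - x * y) ^ i,
        mul_mem hy (sum_mem fun i _ => pow_mem (sub_mem (one_mem _) (mul_mem x.2 hy)) i), ?_⟩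
      have hgeom := mul_neg_geom_sum (1 - (x : A) * y) n
      have : y * v - y * ∑ i ∈ Finset.range n, (1 - (x : A) * y) ^ i =
          y * v * (1 - x * y) ^ n := by
        linear_combination -(y * v) * hgeom +
          (y * ∑ i ∈ Finset.range n, (1 - (x : A) * y) ^ i) * hv
      rw [this]
      exact Ideal.mul_mem_left _ _ (Ideal.pow_mem_pow hw n)
    exact .of_mul_eq_one ⟨y * v, hmem⟩ (Subtype.ext hxv)
  let π : C := (p : C)
  have hπ : (π : A) = p := by simp [π]
  have hnonunit : ∀ x : C, (x : A) ∈ J → ¬ IsUnit x := fun x hx hxu =>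
    (mem_maximalIdeal _).1 (hJm hx) (hxu.map C.subtype)
  have hirr : Irreducible π := by
    refine ⟨hnonunit _ (hπ ▸ hpJ), fun a b hab => ?_⟩
    by_contra! hne
    obtain ⟨a', -, ha⟩ := hdiv a a.2 (by_contra fun h => hne.1 (hunit a h))
    obtain ⟨b', -, hb⟩ := hdiv b b.2 (by_contra fun h => hne.2 (hunit b h))
    have h := congrArg Subtype.val hab
    rw [hπ, Subring.coe_mul, ha, hb] at h
    have h' : (p : A) * (a' * b') = 1 := mul_left_cancel₀ hp0 (by linear_combination -h)
    exact (mem_maximalIdeal _).1 hpm (.of_mul_eq_one _ h')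
  have hfac : ∀ n, ∀ z : C, (z : A) ∈ J ^ n → ∃ w : C, z = π ^ n * w := by
    intro n
    induction n with
    | zero => exact fun z _ => ⟨z, by simp⟩
    | succ n ih =>
      intro z hz
      obtain ⟨w, rfl⟩ := ih z (Ideal.pow_le_pow_right (Nat.le_succ n) hz)
      rw [Subring.coe_mul, Subring.coe_pow, hπ, hmul, pow_succ,
        mul_dvd_mul_iff_left (pow_ne_zero _ hp0), ← Ideal.mem_span_singleton] at hz
      obtain ⟨d, hd, hwd⟩ := hdiv w w.2 hz
      refine ⟨⟨d, hd⟩, Subtype.ext ?_⟩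
      simp only [Subring.coe_mul, Subring.coe_pow, hπ, hwd]
      ring
  have hufd : IsDiscreteValuationRing.HasUnitMulPowIrreducibleFactorization C := by
    classical
    refine ⟨π, hirr, fun {z} hz => ?_⟩
    -- Separatedness gives a nonzero element a finite `p`-adic order; dividing by that power of `p`
    -- leaves a unit.
    have hex : ∃ n, (z : A) ∉ J ^ n := by
      by_contra! h
      refine hz (Subtype.ext ?_)
      rw [ZeroMemClass.coe_zero, IsHausdorff.eq_iff_smodEq (I := J)]
      intro n
      rw [SModEq.sub_mem, smul_eq_mul, Ideal.mul_top, sub_zero]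
      exact h n
    have hpos : Nat.find hex ≠ 0 := fun h => by
      have := Nat.find_spec hex
      rw [h] at this
      simp at this
    obtain ⟨n, hn⟩ := Nat.exists_eq_succ_of_ne_zero hpos
    have hzn : (z : A) ∈ J ^ n := by_contra fun h => by
      have := Nat.find_min' hex h
      lia
    obtain ⟨w, hw⟩ := hfac n z hzn
    have hwu : IsUnit w := hunit w fun h => by
      have h1 := Nat.find_spec hex
      rw [hn, hw, Subring.coe_mul, Subring.coe_pow, hπ, pow_succ] at h1
      exact h1 (Ideal.mul_mem_mul (Ideal.pow_mem_pow hpJ n) h)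
    exact ⟨n, hw ▸ associated_mul_unit_right _ _ hwu⟩
  have hdvr := IsDiscreteValuationRing.ofHasUnitMulPowIrreducibleFactorization hufd
  refine ⟨C, inferInstance, inferInstance, hdvr.toIsLocalRing, hdvr.toIsPrincipalIdealRing,
    C.subtype, fun r => ?_⟩
  obtain ⟨a, rfl⟩ := residue_surjective r
  obtain ⟨c, hc⟩ := hσ (residue _ (Ideal.Quotient.mk J a))
  obtain ⟨x, hx, hxc⟩ := h1 c
  refine ⟨⟨x, hx⟩, ?_⟩
  change residue A x = residue A a
  rw [← sub_eq_zero, ← map_sub, residue_eq_zero_iff]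
  have h4 : Ideal.Quotient.mk J (x - a) ∈ maximalIdeal (A ⧸ J) := by
    rw [← residue_eq_zero_iff, map_sub, map_sub, hxc, sub_eq_zero]
    exact hc
  rw [mem_maximalIdeal] at h4 ⊢
  exact fun h => h4 (h.map _)

/-- A complete noetherian local domain admits a coefficient ring which is a field or a discrete
valuation ring. -/
theorem exists_coefficientRing [IsDomain A] :
    ∃ (C : Type u) (_ : CommRing C) (_ : IsDomain C) (_ : IsLocalRing C)
      (_ : IsPrincipalIdealRing C) (φ : C →+* A), Function.Surjective ((residue A).comp φ) := by
  obtain ⟨p, hchar⟩ := CharP.exists (ResidueField A)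
  rcases CharP.char_is_prime_or_zero (ResidueField A) p with hp | rfl
  · by_cases hpA : (p : A) = 0
    · obtain ⟨K, _, φ, h⟩ := exists_coefficientField_of_natCast_eq_zero A hp hpA
      exact ⟨K, inferInstance, inferInstance, inferInstance, inferInstance, φ, h⟩
    · refine exists_coefficientRing_of_natCast_ne_zero A hp hpA ?_
      rw [← residue_eq_zero_iff, map_natCast, CharP.cast_eq_zero]
  · have := CharP.charP_to_charZero (ResidueField A)
    obtain ⟨K, _, φ, h⟩ := exists_coefficientField_of_charZero A
    exact ⟨K, inferInstance, inferInstance, inferInstance, inferInstance, φ, h⟩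

end CoefficientRing

/-! ### Complete local domains as quotients of Cohen-Macaulay rings -/

section CohenPresentation

open IsLocalRing RingTheory.Sequence
open scoped Pointwise

/-- A local ring is Cohen-Macaulay if it has a regular sequence whose length is the dimension. -/
def IsLocalCohenMacaulay (R : Type*) [CommRing R] : Prop :=
  ∃ rs : List R, IsRegular R rs ∧ (rs.length : WithBot ℕ∞) = ringKrullDim R

/-- Lift a maximal regular sequence of `S = R ⧸ x` and put `x` in front; the dimension also rises by
exactly one. -/
theorem IsLocalCohenMacaulay.of_surjective {R S : Type*} [CommRing R] [IsLocalRing R]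
    [IsNoetherianRing R] [CommRing S] (f : R →+* S) (hf : Function.Surjective f) {x : R}
    (hker : RingHom.ker f = Ideal.span {x}) (hxm : x ∈ maximalIdeal R)
    (hx : x ∈ nonZeroDivisors R) (hS : IsLocalCohenMacaulay S) : IsLocalCohenMacaulay R := by
  obtain ⟨rs, hrs, hlen⟩ := hS
  obtain ⟨rs', rfl⟩ := List.map_surjective_iff.2 hf rs
  have hk : (x • ⊤ : Submodule R R) = RingHom.ker f := by
    rw [hker, ← Submodule.ideal_span_singleton_smul, smul_eq_mul, Ideal.mul_top]
  let e : QuotSMulTop x R ≃+ S := (Submodule.quotEquivOfEq _ _ hk).toAddEquiv.trans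
    (RingHom.quotientKerEquivOfSurjective hf).toAddEquiv
  have he : ∀ y : R, e (Submodule.Quotient.mk y) = f y := fun y => rfl
  have hdim : ringKrullDim R = ringKrullDim S + 1 := by
    rw [← ringKrullDim_quotient_span_singleton_succ_eq_ringKrullDim_of_mem_nonZeroDivisors hx hxm,
      ← hker, ringKrullDim_eq_of_ringEquiv (RingHom.quotientKerEquivOfSurjective hf)]
  refine ⟨x :: rs', (isRegular_cons_iff R x rs').2
    ⟨Module.Flat.isSMulRegular_of_nonZeroDivisors hx, ?_⟩, ?_⟩
  · refine (AddEquiv.isRegular_congr (e := e) (List.forall₂_map_right_iff.mpr <|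
      List.forall₂_same.mpr fun r _ => ?_)).2 hrs
    refine (Submodule.Quotient.mk_surjective _).forall.2 fun y => ?_
    rw [← Submodule.Quotient.mk_smul, he, he, smul_eq_mul, map_mul, smul_eq_mul]
  · rw [hdim, ← hlen]
    simp

theorem IsLocalCohenMacaulay.of_krullDimLE_zero (R : Type*) [CommRing R] [Nontrivial R]
    (h : ringKrullDim R = 0) : IsLocalCohenMacaulay R :=
  ⟨[], IsRegular.nil R R, by simp [h]⟩

theorem IsLocalCohenMacaulay.of_isPrincipalIdealRing (R : Type*) [CommRing R] [IsDomain R]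
    [IsLocalRing R] [IsPrincipalIdealRing R] : IsLocalCohenMacaulay R := by
  by_cases hR : IsField R
  · exact .of_krullDimLE_zero R (ringKrullDim_eq_zero_of_isField hR)
  · obtain ⟨x, hx⟩ := (IsPrincipalIdealRing.principal (maximalIdeal R)).principal
    have hx0 : x ≠ 0 := by
      rintro rfl
      rw [isField_iff_maximalIdeal_eq] at hR
      exact hR (by simp [hx])
    refine .of_surjective (residue R) residue_surjective (x := x) ?_ ?_
      (mem_nonZeroDivisors_of_ne_zero hx0)
      (.of_krullDimLE_zero _ (ringKrullDim_eq_zero_of_field (ResidueField R)))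
    · rw [ker_residue, hx]
    · rw [hx]; exact Submodule.mem_span_singleton_self x

theorem IsLocalCohenMacaulay.powerSeries {R : Type*} [CommRing R] [IsLocalRing R]
    [IsNoetherianRing R] (h : IsLocalCohenMacaulay R) :
    IsLocalCohenMacaulay (PowerSeries R) := by
  refine .of_surjective PowerSeries.constantCoeff PowerSeries.constantCoeff_surj
    (x := PowerSeries.X) ?_ ?_ ?_ h
  · ext f
    rw [RingHom.mem_ker, Ideal.mem_span_singleton, PowerSeries.X_dvd_iff]
  · rw [mem_maximalIdeal, mem_nonunits_iff, PowerSeries.isUnit_iff_constantCoeff]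
    simp
  · rw [mem_nonZeroDivisors_iff_right]
    intro f hf
    ext n
    simpa using congrArg (PowerSeries.coeff (n + 1)) hf

theorem exists_powerSeries_eval {P A : Type*} [CommRing P] [CommRing A] (I : Ideal A)
    [IsAdicComplete I A] (φ : P →+* A) {a : A} (ha : a ∈ I) :
    ∃ ψ : PowerSeries P →+* A, ψ PowerSeries.X = a ∧ ψ.comp PowerSeries.C = φ := by
  let _ : UniformSpace P := ⊥
  have : DiscreteTopology P := ⟨rfl⟩
  let _ : WithIdeal A := ⟨I⟩
  have hI : IsAdic I := rfl
  obtain ⟨_, _⟩ := hI.isAdicComplete_iff.1 inferInstance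
  have : IsLinearTopology A A := I.isLinearTopology
  have : IsUniformAddGroup P := inferInstance
  have ha' : PowerSeries.HasEval a := by
    refine I.hasBasis_nhds_zero_adic.tendsto_right_iff.2 fun n _ => ?_
    exact Filter.eventually_atTop.2 ⟨n, fun m hm =>
      Ideal.pow_le_pow_right hm (Ideal.pow_mem_pow ha m)⟩
  let ψ := PowerSeries.eval₂Hom (φ := φ) continuous_of_discreteTopology ha'
  refine ⟨ψ, ?_, RingHom.ext fun r => ?_⟩
  · rw [PowerSeries.coe_eval₂Hom, PowerSeries.eval₂_X]
  · rw [RingHom.comp_apply, PowerSeries.coe_eval₂Hom, PowerSeries.eval₂_C]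

/-- Each generator of the ideal is traded for a power series variable sent to it. Surjectivity
modulo `X` lifts because power series are `X`-adically complete and the target is separated. -/
theorem exists_surjective_of_surjective_quotient {A : Type u} [CommRing A] [IsLocalRing A]
    [IsNoetherianRing A] [IsAdicComplete (maximalIdeal A) A] (s : Finset A)
    (hs : ∀ a ∈ s, a ∈ maximalIdeal A) (P : Type u) [CommRing P] [IsLocalRing P]
    [IsNoetherianRing P] (hP : IsLocalCohenMacaulay P) (φ : P →+* A)
    (hφ : Function.Surjective ((Ideal.Quotient.mk (Ideal.span (s : Set A))).comp φ)) :
    ∃ (Q : Type u) (_ : CommRing Q) (_ : IsLocalRing Q) (_ : IsNoetherianRing Q) (ψ : Q →+* A),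
      IsLocalCohenMacaulay Q ∧ Function.Surjective ψ := by
  classical
  induction s using Finset.induction_on generalizing P with
  | empty =>
    refine ⟨P, inferInstance, inferInstance, inferInstance, φ, hP, fun a => ?_⟩
    obtain ⟨x, hx⟩ := hφ (Ideal.Quotient.mk _ a)
    have := Ideal.Quotient.eq.1 hx
    simp only [Finset.coe_empty, Ideal.span_empty, Ideal.mem_bot, sub_eq_zero] at this
    exact ⟨x, this⟩
  | insert a s ha ih =>
    obtain ⟨ψ, hψX, hψC⟩ := exists_powerSeries_eval (maximalIdeal A) φ (hs a (by simp))
    refine ih (fun b hb => hs b (by simp [hb])) (PowerSeries P) hP.powerSeries ψ ?_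
    set J := Ideal.span (s : Set A)
    have hJ : J ≠ ⊤ := fun h => (maximalIdeal.isMaximal A).ne_top
      (top_le_iff.1 (h ▸ Ideal.span_le.2 fun b hb => hs b (by simp [Finset.mem_coe.1 hb])))
    have : Nontrivial (A ⧸ J) := Ideal.Quotient.nontrivial_iff.2 hJ
    have : IsLocalRing (A ⧸ J) := .of_surjective' _ Ideal.Quotient.mk_surjective
    set θ := (Ideal.Quotient.mk J).comp ψ
    have hmap : (Ideal.span {PowerSeries.X}).map θ = Ideal.span {Ideal.Quotient.mk J a} := by
      rw [Ideal.map_span, Set.image_singleton]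
      simp [θ, hψX]
    have : IsHausdorff ((Ideal.span {PowerSeries.X}).map θ) (A ⧸ J) := by
      refine IsHausdorff.of_isLocalRing _ _ ?_
      rw [hmap, Ne, Ideal.span_singleton_eq_top]
      intro hu
      have : Ideal.Quotient.mk J a ∈ maximalIdeal (A ⧸ J) := by
        rw [← IsLocalRing.map_maximalIdeal_of_surjective _ Ideal.Quotient.mk_surjective]
        exact Ideal.mem_map_of_mem _ (hs a (by simp))
      exact (mem_maximalIdeal _).1 this hu
    refine surjective_of_mk_map_comp_surjective (I := Ideal.span {PowerSeries.X}) θ ?_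
    intro y
    obtain ⟨y, rfl⟩ := Ideal.Quotient.mk_surjective y
    obtain ⟨y, rfl⟩ := Ideal.Quotient.mk_surjective y
    obtain ⟨x, hx⟩ := hφ (Ideal.Quotient.mk _ y)
    refine ⟨PowerSeries.C x, Ideal.Quotient.eq.2 ?_⟩
    have hx' : φ x - y ∈ Ideal.span ((insert a s : Finset A) : Set A) := Ideal.Quotient.eq.1 hx
    have h1 : θ (PowerSeries.C x) = Ideal.Quotient.mk J (φ x) := by
      rw [← hψC]; rfl
    rw [h1, ← map_sub, hmap]
    rw [Finset.coe_insert] at hx'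
    have := Ideal.mem_map_of_mem (Ideal.Quotient.mk J) hx'
    rw [Ideal.map_span, Set.image_insert_eq] at this
    refine Ideal.span_le.2 ?_ this
    rintro _ (rfl | ⟨b, hb, rfl⟩)
    · exact Ideal.subset_span rfl
    · rw [Ideal.Quotient.eq_zero_iff_mem.2 (Ideal.subset_span hb)]
      exact zero_mem _

/-- A complete noetherian local domain is a quotient of a Cohen-Macaulay noetherian local ring. -/
theorem exists_surjective_isLocalCohenMacaulay (A : Type u) [CommRing A] [IsLocalRing A]
    [IsNoetherianRing A] [IsDomain A] [IsAdicComplete (maximalIdeal A) A] :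
    ∃ (Q : Type u) (_ : CommRing Q) (_ : IsLocalRing Q) (_ : IsNoetherianRing Q) (ψ : Q →+* A),
      IsLocalCohenMacaulay Q ∧ Function.Surjective ψ := by
  obtain ⟨C, _, _, _, _, φ, hφ⟩ := exists_coefficientRing A
  obtain ⟨s, hs⟩ := (isNoetherianRing_iff_ideal_fg A).1 inferInstance (maximalIdeal A)
  refine exists_surjective_of_surjective_quotient s (fun a ha => hs ▸ Ideal.subset_span ha) C
    (.of_isPrincipalIdealRing C) φ ?_
  intro y
  obtain ⟨y, rfl⟩ := Ideal.Quotient.mk_surjective y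
  obtain ⟨x, hx⟩ := hφ (residue A y)
  refine ⟨x, Ideal.Quotient.eq.2 ?_⟩
  rw [hs]
  exact Ideal.Quotient.eq.1 hx

end CohenPresentation

/-! ### Depth and regular sequences inside a prime -/

section Depth

open IsLocalRing RingTheory.Sequence Abelian
open scoped Pointwise

variable {R : Type u} [CommRing R] [IsNoetherianRing R] [IsLocalRing R]

omit [IsNoetherianRing R] in
theorem RingTheory.Sequence.IsRegular.mem_maximalIdeal {M : Type*} [AddCommGroup M] [Module R M]
    {rs : List R} (h : IsRegular M rs) {x : R} (hx : x ∈ rs) : x ∈ maximalIdeal R := by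
  refine IsLocalRing.le_maximalIdeal ?_ (Ideal.subset_span hx : x ∈ Ideal.ofList rs)
  intro H
  exact h.2 (((congrArg (· • (⊤ : Submodule R M)) H).trans (Submodule.top_smul _)).symm)

/-- Dividing out a regular element lowers the length of a regular sequence by at most one. -/
theorem exists_isRegular_quotSMulTop {M : Type u} [AddCommGroup M] [Module R M] [Module.Finite R M]
    {rs : List R} (h : IsRegular M rs) {n : ℕ} (hn : n < rs.length) {x : R}
    (hx : x ∈ maximalIdeal R) (hxM : IsSMulRegular M x) :
    ∃ rs' : List R, rs'.length = n ∧ IsRegular (QuotSMulTop x M) rs' := by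
  have := h.nontrivial
  have hlt : ∀ (L : Type u) [AddCommGroup L] [Module R L] [Module.Finite R L] [Nontrivial L],
      maximalIdeal R • (⊤ : Submodule R L) < ⊤ := fun L _ _ _ _ =>
    lt_top_iff_ne_top.mpr
      (Submodule.top_ne_ideal_smul_of_le_jacobson_annihilator (maximalIdeal_le_jacobson _)).symm
  have := nontrivial_quotSMulTop_of_mem_maximalIdeal M hx
  have supp : Module.support R (R ⧸ maximalIdeal R) =
      PrimeSpectrum.zeroLocus (maximalIdeal R) := by
    rw [Module.support_eq_zeroLocus, Ideal.annihilator_quotient]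
  -- Depth is detected by vanishing of `Ext i (k, M)` for the residue field `k`; the long exact
  -- sequence of multiplication by `x` loses only one degree.
  have hext := ModuleCat.subsingleton_ext_of_exists_isRegular (maximalIdeal R)
    (ModuleCat.of R (R ⧸ maximalIdeal R)) supp.subset (ModuleCat.of R M) (hlt M) rs
    (fun r hr => h.mem_maximalIdeal hr) h
  obtain ⟨rs', h1, -, h2⟩ := ModuleCat.exists_isRegular_of_exists_subsingleton_ext (maximalIdeal R)
    n (ModuleCat.of R (QuotSMulTop x M)) (hlt (QuotSMulTop x M))
    (ModuleCat.of R (R ⧸ maximalIdeal R)) supp (fun i hi => by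
      have zero1 := AddCommGrpCat.isZero_of_iff_subsingleton.mpr (hext i (by omega))
      have zero2 := AddCommGrpCat.isZero_of_iff_subsingleton.mpr (hext (i + 1) (by omega))
      exact AddCommGrpCat.subsingleton_of_isZero <| ShortComplex.Exact.isZero_of_both_zeros
        ((Ext.covariant_sequence_exact₃' _
          (IsSMulRegular.smulShortComplex_shortExact (M := ModuleCat.of R M) hxM)) i (i + 1) rfl)
        (zero1.eq_zero_of_src _) (zero2.eq_zero_of_tgt _))
  exact ⟨rs', h1, h2⟩

omit [IsLocalRing R] in
theorem IsAssociatedPrime.exists_colon_eq {M : Type*} [AddCommGroup M] [Module R M] {Q : Ideal R}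
    (hQ : IsAssociatedPrime Q M) : ∃ z : M, z ≠ 0 ∧ ∀ a, a ∈ Q ↔ a • z = 0 := by
  obtain ⟨hp, z, hz⟩ := isAssociatedPrime_iff.mp hQ
  have h : ∀ a, a ∈ Q ↔ a • z = 0 := fun a => by
    rw [hz, Submodule.mem_colon_singleton, Submodule.mem_bot]
  refine ⟨z, fun h0 => hp.ne_top ((Ideal.eq_top_iff_one _).mpr ?_), h⟩
  rw [h, h0, smul_zero]

/-- The length of a regular sequence is bounded by the dimension of every associated prime. -/
theorem RingTheory.Sequence.IsRegular.length_le_ringKrullDim {M : Type u} [AddCommGroup M]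
    [Module R M] [Module.Finite R M] {rs : List R} (h : IsRegular M rs) {Q : Ideal R}
    (hQ : IsAssociatedPrime Q M) : (rs.length : WithBot ℕ∞) ≤ ringKrullDim (R ⧸ Q) := by
  induction rs generalizing M Q with
  | nil =>
    have := Ideal.Quotient.nontrivial_iff.mpr hQ.isPrime.ne_top
    simpa using ringKrullDim_nonneg_of_nontrivial
  | cons x rs ih =>
    have hxm : x ∈ maximalIdeal R := h.mem_maximalIdeal List.mem_cons_self
    rw [isRegular_cons_iff] at h
    obtain ⟨hx, h⟩ := h
    have hxQ : x ∉ Q := by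
      obtain ⟨z, hz, hzQ⟩ := hQ.exists_colon_eq
      intro hxQ
      exact hz (hx (((hzQ x).mp hxQ).trans (smul_zero x).symm))
    let N : Submodule R M :=
      { carrier := {z | ∀ a ∈ Q, a • z = 0}
        add_mem' := fun {y z} hy hz a ha => by rw [smul_add, hy a ha, hz a ha, add_zero]
        zero_mem' := fun a _ => smul_zero a
        smul_mem' := fun r z hz a ha => by rw [smul_comm, hz a ha, smul_zero] }
    -- Otherwise regularity of `x` gives `N = x N`, hence `N = 0` by Nakayama. So some element
    -- killed by `Q` survives in `M ⧸ x M`, and an associated prime over its annihilator contains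
    -- both `Q` and `x`.
    have hN : ¬ N ≤ x • (⊤ : Submodule R M) := by
      intro hle
      have : N ≤ maximalIdeal R • N := by
        intro z hz
        obtain ⟨y, -, rfl⟩ := hle hz
        refine Submodule.smul_mem_smul hxm fun a ha => ?_
        have h1 := hz a ha
        change a • x • y = 0 at h1
        rw [smul_comm] at h1
        exact hx (h1.trans (smul_zero x).symm)
      have hbot : N = ⊥ := Submodule.eq_bot_of_le_smul_of_le_jacobson_bot _ N
        (IsNoetherian.noetherian N) this (maximalIdeal_le_jacobson _)
      obtain ⟨z, hz, hzQ⟩ := hQ.exists_colon_eq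
      have : z ∈ N := fun a ha => (hzQ a).mp ha
      rw [hbot] at this
      exact hz this
    obtain ⟨z, hzN, hz⟩ := Set.not_subset.mp hN
    let zb : QuotSMulTop x M := Submodule.Quotient.mk z
    obtain ⟨Q', hQ', hle⟩ := exists_le_isAssociatedPrime_of_isNoetherianRing R zb
      ((Submodule.Quotient.mk_eq_zero _).not.mpr hz)
    have hann : ∀ a : R, a • zb = 0 → a ∈ Q' := fun a ha => hle (by
      rwa [Submodule.mem_colon_singleton, Submodule.mem_bot])
    have hQQ' : Q ≤ Q' := fun a ha => hann a (by
      rw [← Submodule.Quotient.mk_smul, hzN a ha, Submodule.Quotient.mk_zero])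
    have hxQ' : x ∈ Q' := hann x (by
      rw [← Submodule.Quotient.mk_smul, Submodule.Quotient.mk_eq_zero]
      exact Submodule.smul_mem_pointwise_smul _ _ _ trivial)
    have hQp := hQ.isPrime
    have key := ringKrullDim_succ_le_of_surjective (Ideal.Quotient.factor hQQ')
      (Ideal.Quotient.factor_surjective hQQ') (r := Ideal.Quotient.mk Q x)
      (mem_nonZeroDivisors_of_ne_zero (by rwa [Ne, Ideal.Quotient.eq_zero_iff_mem]))
      (by rwa [Ideal.Quotient.factor_mk, Ideal.Quotient.eq_zero_iff_mem])
    refine le_trans ?_ key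
    rw [List.length_cons]
    push_cast
    exact add_le_add_left (ih h hQ') 1

/-- If `Q` consisted of zero divisors, prime avoidance would put it in an associated prime, whose
quotient has dimension too small for the length of the sequence. -/
theorem exists_isSMulRegular_mem_of_lt {M : Type u} [AddCommGroup M] [Module R M]
    [Module.Finite R M] {rs : List R} (h : IsRegular M rs) {Q : Ideal R} [Q.IsPrime]
    (hQ : ringKrullDim (R ⧸ Q) < rs.length) : ∃ x ∈ Q, IsSMulRegular M x := by
  by_contra! hcon
  have hsub : (Q : Set R) ⊆ ⋃ P ∈ associatedPrimes R M, P := by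
    intro x hx
    have := hcon x hx
    rw [biUnion_associatedPrimes_eq_compl_regular]
    exact this
  rw [Ideal.subset_union_prime_finite (associatedPrimes.finite R M) ⊥ ⊥
    fun P hP _ _ => IsAssociatedPrime.isPrime hP] at hsub
  obtain ⟨P, hP, hle⟩ := hsub
  have := h.length_le_ringKrullDim hP
  have h2 := ringKrullDim_le_of_surjective _ (Ideal.Quotient.factor_surjective hle)
  exact absurd (this.trans h2) hQ.not_ge

/-- A prime ideal `Q` contains a regular sequence of length the depth minus `dim R ⧸ Q`. -/
theorem exists_isRegular_mem_of_add_le {M : Type u} [AddCommGroup M] [Module R M]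
    [Module.Finite R M] {rs : List R} (h : IsRegular M rs) (Q : Ideal R) [Q.IsPrime] (k : ℕ)
    (hk : ringKrullDim (R ⧸ Q) + k ≤ rs.length) :
    ∃ xs : List R, xs.length = k ∧ (∀ x ∈ xs, x ∈ Q) ∧ IsRegular M xs := by
  induction k generalizing M rs with
  | zero =>
    have := h.nontrivial
    exact ⟨[], rfl, by simp, .nil R M⟩
  | succ k ih =>
    have hQ0 : 0 ≤ ringKrullDim (R ⧸ Q) := ringKrullDim_nonneg_of_nontrivial
    obtain ⟨e, he⟩ : ∃ e : ℕ, ringKrullDim (R ⧸ Q) = e := by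
      have hlt : ringKrullDim (R ⧸ Q) < ⊤ :=
        (ringKrullDim_quotient_le Q).trans_lt ringKrullDim_lt_top
      revert hQ0 hlt
      generalize ringKrullDim (R ⧸ Q) = t
      intro h0 h1
      obtain ⟨s, rfl⟩ := WithBot.ne_bot_iff_exists.mp (ne_bot_of_le_ne_bot (by simp) h0)
      obtain ⟨e, rfl⟩ := ENat.ne_top_iff_exists.mp (show s ≠ ⊤ by rintro rfl; exact lt_irrefl _ h1)
      exact ⟨e, rfl⟩
    rw [he] at hk
    have hk' : e + (k + 1) ≤ rs.length := by exact_mod_cast hk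
    obtain ⟨x, hxQ, hx⟩ := exists_isSMulRegular_mem_of_lt h (Q := Q) (by
      rw [he]; exact_mod_cast (by omega : e < rs.length))
    obtain ⟨rs', hl, h'⟩ := exists_isRegular_quotSMulTop h (n := rs.length - 1) (by omega)
      (IsLocalRing.le_maximalIdeal (Ideal.IsPrime.ne_top ‹_›) hxQ) hx
    obtain ⟨xs, h1, h2, h3⟩ := ih h' (by
      rw [he, hl]; exact_mod_cast (by omega : e + k ≤ rs.length - 1))
    exact ⟨x :: xs, by simp [h1], by simpa [hxQ] using h2, by simpa using ⟨hx, h3⟩⟩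

end Depth

/-! ### Dimension formula, localization and polynomial extension for Cohen-Macaulay rings -/

section CohenMacaulay

open IsLocalRing RingTheory.Sequence
open scoped Pointwise

theorem PrimeSpectrum.ringKrullDim_quotient_eq_coheight {R : Type*} [CommRing R]
    (q : PrimeSpectrum R) :
    ringKrullDim (R ⧸ q.asIdeal) = ((Order.coheight q : ℕ∞) : WithBot ℕ∞) := by
  rw [ringKrullDim_quotient, Order.coheight_eq_krullDim_Ici]
  congr 1

theorem Ideal.height_add_ringKrullDim_quotient_le {R : Type*} [CommRing R] (Q : Ideal R)
    [Q.IsPrime] : (Q.height : WithBot ℕ∞) + ringKrullDim (R ⧸ Q) ≤ ringKrullDim R := by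
  let q : PrimeSpectrum R := ⟨Q, inferInstance⟩
  have : Nonempty (PrimeSpectrum R) := ⟨q⟩
  have h1 : ringKrullDim (R ⧸ Q) = (Order.coheight q : ℕ∞) :=
    q.ringKrullDim_quotient_eq_coheight
  have h2 : Q.height = Order.height q := PrimeSpectrum.height_eq_orderHeight q
  rw [h1, h2, ringKrullDim, Order.krullDim_eq_iSup_height_add_coheight_of_nonempty]
  exact_mod_cast le_iSup (fun a : PrimeSpectrum R => Order.height a + Order.coheight a) q

theorem exists_ringKrullDim_eq_natCast (R : Type*) [CommRing R] [Nontrivial R]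
    (h : ringKrullDim R < ⊤) : ∃ e : ℕ, ringKrullDim R = e := by
  have h0 : 0 ≤ ringKrullDim R := ringKrullDim_nonneg_of_nontrivial
  revert h0 h
  generalize ringKrullDim R = t
  intro h1 h0
  obtain ⟨s, rfl⟩ := WithBot.ne_bot_iff_exists.mp (ne_bot_of_le_ne_bot (by simp) h0)
  obtain ⟨e, rfl⟩ := ENat.ne_top_iff_exists.mp (show s ≠ ⊤ by rintro rfl; exact lt_irrefl _ h1)
  exact ⟨e, rfl⟩

theorem IsLocalCohenMacaulay.of_ringEquiv {R S : Type*} [CommRing R] [CommRing S] (e : R ≃+* S)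
    (h : IsLocalCohenMacaulay R) : IsLocalCohenMacaulay S := by
  obtain ⟨rs, hrs, hl⟩ := h
  refine ⟨rs.map e, ?_, by rw [List.length_map, hl, ringKrullDim_eq_of_ringEquiv e]⟩
  refine (AddEquiv.isRegular_congr (e := e.toAddEquiv) (List.forall₂_map_right_iff.mpr <|
      List.forall₂_same.mpr fun r _ y => ?_)).1 hrs
  simp

/-- Depth supplies a regular sequence in `Q` of length `dim R - dim R ⧸ Q`. It remains regular at
`Q`, bounding the height from below; the bound from above holds in any ring. -/
theorem IsLocalCohenMacaulay.exists_isRegular_mem {R : Type u} [CommRing R] [IsNoetherianRing R]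
    [IsLocalRing R] (h : IsLocalCohenMacaulay R) (Q : Ideal R) [Q.IsPrime] :
    ∃ (e : ℕ) (xs : List R), ringKrullDim (R ⧸ Q) = e ∧ ringKrullDim R = (e + xs.length : ℕ) ∧
      Q.height = xs.length ∧ (∀ x ∈ xs, x ∈ Q) ∧ IsRegular R xs := by
  obtain ⟨rs, hrs, hl⟩ := h
  have hle := ringKrullDim_quotient_le Q
  obtain ⟨e, he⟩ := exists_ringKrullDim_eq_natCast (R ⧸ Q) (hle.trans_lt ringKrullDim_lt_top)
  have hen : e ≤ rs.length := by rw [← hl, he] at hle; exact_mod_cast hle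
  obtain ⟨xs, h1, h2, h3⟩ := exists_isRegular_mem_of_add_le hrs Q (rs.length - e) (by
    rw [he]; exact_mod_cast (by omega : e + (rs.length - e) ≤ rs.length))
  refine ⟨e, xs, he, by rw [← hl, h1]; norm_cast; omega, ?_, h2, h3⟩
  let L := Localization.AtPrime Q
  have hreg := h3.toIsWeaklyRegular.isRegular_of_isLocalization_of_mem L Q h2
  have hd := ringKrullDim_add_length_eq_ringKrullDim_of_isRegular _ hreg
  rw [IsLocalization.AtPrime.ringKrullDim_eq_height Q L, List.length_map] at hd
  have : Nontrivial (L ⧸ Ideal.ofList (xs.map (algebraMap R L))) :=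
    Ideal.Quotient.nontrivial_iff.mpr fun H => hreg.2 (by rw [H, Submodule.top_smul])
  have h0 : 0 ≤ ringKrullDim (L ⧸ Ideal.ofList (xs.map (algebraMap R L))) :=
    ringKrullDim_nonneg_of_nontrivial
  have hge : (xs.length : WithBot ℕ∞) ≤ Q.height := by
    rw [← hd]; exact le_add_of_nonneg_left h0
  have hge' : (xs.length : ℕ∞) ≤ Q.height := by exact_mod_cast hge
  have hub := Q.height_add_ringKrullDim_quotient_le
  rw [he, ← hl] at hub
  have hub' : Q.height + (e : ℕ∞) ≤ rs.length := by exact_mod_cast hub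
  refine le_antisymm ?_ hge'
  rw [show rs.length = xs.length + e by omega, Nat.cast_add] at hub'
  exact (ENat.add_le_add_iff_right (ENat.natCast_ne_top e)).mp hub'

/-- In a Cohen-Macaulay local ring, `ht Q + dim R ⧸ Q = dim R`. -/
theorem IsLocalCohenMacaulay.height_add_ringKrullDim_quotient {R : Type u} [CommRing R]
    [IsNoetherianRing R] [IsLocalRing R] (h : IsLocalCohenMacaulay R) (Q : Ideal R) [Q.IsPrime] :
    (Q.height : WithBot ℕ∞) + ringKrullDim (R ⧸ Q) = ringKrullDim R := by
  obtain ⟨e, xs, h1, h2, h3, -⟩ := h.exists_isRegular_mem Q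
  rw [h1, h2, h3, add_comm]
  norm_cast

theorem IsLocalCohenMacaulay.localization {R : Type u} [CommRing R]
    [IsNoetherianRing R] [IsLocalRing R] (h : IsLocalCohenMacaulay R) (Q : Ideal R) [Q.IsPrime]
    (L : Type*) [CommRing L] [Algebra R L] [IsLocalization.AtPrime L Q] :
    IsLocalCohenMacaulay L := by
  obtain ⟨e, xs, h1, h2, h3, h4, h5⟩ := h.exists_isRegular_mem Q
  refine ⟨_, h5.toIsWeaklyRegular.isRegular_of_isLocalization_of_mem L Q h4, ?_⟩
  rw [IsLocalization.AtPrime.ringKrullDim_eq_height Q L, h3, List.length_map]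
  norm_cast

-- A monic polynomial remains monic, hence a nonzerodivisor, modulo any ideal of the base.
open Polynomial in
theorem RingTheory.Sequence.IsWeaklyRegular.append_monic {A : Type*} [CommRing A] {rs : List A}
    (h : IsWeaklyRegular A rs) {f : A[X]} (hf : f.Monic) :
    IsWeaklyRegular A[X] (rs.map C ++ [f]) := by
  rw [isWeaklyRegular_append_iff]
  refine ⟨h.of_flat, ?_⟩
  rw [isWeaklyRegular_singleton_iff, isSMulRegular_quotient_iff_mem_of_smul_mem]
  have hI : (Ideal.ofList (rs.map C) • (⊤ : Submodule A[X] A[X])) =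
      RingHom.ker (mapRingHom (Ideal.Quotient.mk (Ideal.ofList rs))) := by
    rw [Polynomial.ker_mapRingHom, Ideal.mk_ker, Ideal.map_ofList, smul_eq_mul, Ideal.mul_top]
  rw [hI]
  intro g hg
  rw [smul_eq_mul, RingHom.mem_ker, map_mul] at hg
  exact ((hf.map _).mul_right_eq_zero_iff).mp hg

open Polynomial in
theorem IsLocalCohenMacaulay.polynomial {A : Type*} [CommRing A] (h : IsLocalCohenMacaulay A)
    (M : Ideal A[X]) [M.IsPrime] (hM : ∀ rs : List A, IsRegular A rs → ∀ r ∈ rs, C r ∈ M)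
    {f : A[X]} (hf : f.Monic) (hfM : f ∈ M)
    (hh : (M.height : WithBot ℕ∞) = ringKrullDim A + 1) (L : Type*) [CommRing L] [Algebra A[X] L]
    [IsLocalization.AtPrime L M] : IsLocalCohenMacaulay L := by
  obtain ⟨rs, hrs, hl⟩ := h
  refine ⟨_, (hrs.toIsWeaklyRegular.append_monic hf).isRegular_of_isLocalization_of_mem L M ?_, ?_⟩
  · intro r hr
    rw [List.mem_append, List.mem_map, List.mem_singleton] at hr
    obtain ⟨a, ha, rfl⟩ | rfl := hr
    · exact hM rs hrs a ha
    · exact hfM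
  · rw [IsLocalization.AtPrime.ringKrullDim_eq_height M L, hh, ← hl]
    simp

-- The Jacobson property makes the contraction `q` of `M` maximal. After localizing the base at `q`,
-- a regular sequence of length `ht q` is extended by a monic polynomial in `M`, reaching length `ht
-- q + 1 = ht M`.
open Polynomial Ideal in
theorem IsLocalCohenMacaulay.localization_polynomial {R : Type*} [CommRing R] [IsNoetherianRing R]
    [IsJacobsonRing R] (M : Ideal R[X]) [M.IsMaximal]
    (h : IsLocalCohenMacaulay (Localization.AtPrime (M.comap C))) :
    IsLocalCohenMacaulay (Localization.AtPrime M) := by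
  let q := M.comap C
  have hq : q.IsMaximal := Polynomial.isMaximal_comap_C_of_isJacobsonRing M
  let A := Localization.AtPrime q
  let S := A[X]
  let pc := Submonoid.map Polynomial.C.toMonoidHom q.primeCompl
  let : Algebra R[X] S := algebra R A
  have : IsLocalization pc S := Polynomial.isLocalization _ _
  let pS := M.map (algebraMap R[X] S)
  have disj : Disjoint (pc : Set R[X]) (M : Set R[X]) := by
    simpa [pc, q] using! Set.disjoint_image_left.mpr
      (Set.disjoint_compl_left_iff_subset.mpr (fun _ a ↦ a))
  have hunder := IsLocalization.under_map_of_isPrime_disjoint pc S ‹M.IsMaximal›.isPrime disj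
  have : pS.IsPrime := IsLocalization.isPrime_of_isPrime_disjoint pc _ _
    ‹M.IsMaximal›.isPrime disj
  have : IsLocalization.AtPrime (Localization.AtPrime pS) M := by
    convert IsLocalization.isLocalization_isLocalization_atPrime_isLocalization pc
      (Localization.AtPrime pS) pS
    exact hunder.symm
  have eq : comap C pS = maximalIdeal A := by
    rw [← IsLocalization.map_under q.primeCompl _ (comap C pS),
      ← IsLocalization.map_under q.primeCompl _ (maximalIdeal A)]
    simp only [comap_comap, S, pS]
    rw [← Polynomial.algebraMap_eq (R := A),
      ← IsScalarTower.algebraMap_eq R A A[X],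
      IsScalarTower.algebraMap_eq R R[X] A[X], ← comap_comap,
      ← Ideal.under_def R[X], hunder]
    simp [q, IsLocalization.AtPrime.under_maximalIdeal A q]
  have : M.LiesOver q := ⟨rfl⟩
  have hMq := height_eq_height_add_one q M
  -- `M` is not the extension of `q`, since that extension has height only `ht q`.
  obtain ⟨f, hf, hfM⟩ := Polynomial.exists_monic_span_sup_map_eq R M hq (fun hne => by
    rw [(congrArg Ideal.height hne).trans (height_map_C q)] at hMq
    exact (ENat.lt_add_one_iff (Ideal.height_ne_top_of_isPrime (I := q))).mpr le_rfl |>.ne hMq)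
  have hfM' : f ∈ M := by
    rw [hfM]; exact Ideal.mem_sup_right (Ideal.mem_span_singleton_self f)
  have hheight : (pS.height : WithBot ℕ∞) = ringKrullDim A + 1 := by
    rw [IsLocalization.height_map_of_disjoint pc M disj, hMq,
      IsLocalization.AtPrime.ringKrullDim_eq_height q A]
    norm_cast
  have key : IsLocalCohenMacaulay (Localization.AtPrime pS) := by
    refine h.polynomial pS (fun rs hrs r hr => ?_) (hf.map (algebraMap R A))
      (Ideal.mem_map_of_mem _ hfM') hheight _
    change r ∈ comap C pS
    rw [eq]
    exact hrs.mem_maximalIdeal hr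
  exact key.of_ringEquiv (IsLocalization.algEquiv M.primeCompl
    (Localization.AtPrime pS) (Localization.AtPrime M)).toRingEquiv

end CohenMacaulay

/-! ### Cohen-Macaulay rings whose maximal ideals have equal height -/

section Equicodimensional

open IsLocalRing

/-- All maximal ideals have height `d` and all localizations at them are Cohen-Macaulay. -/
structure IsEquicodimensionalCM (T : Type*) [CommRing T] (d : ℕ) : Prop where
  height_eq : ∀ (M : Ideal T) [M.IsMaximal], M.height = d
  isLocalCohenMacaulay : ∀ (M : Ideal T) [M.IsMaximal],
    IsLocalCohenMacaulay (Localization.AtPrime M)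

namespace IsEquicodimensionalCM

theorem of_ringEquiv {T T' : Type*} [CommRing T] [CommRing T'] {d : ℕ} (e : T ≃+* T')
    (h : IsEquicodimensionalCM T d) : IsEquicodimensionalCM T' d where
  height_eq M _ := by
    have : (M.comap e).IsMaximal := Ideal.comap_isMaximal_of_equiv e
    rw [← RingEquiv.height_comap e]
    exact h.height_eq _
  isLocalCohenMacaulay M _ := by
    have : (M.comap e).IsMaximal := Ideal.comap_isMaximal_of_equiv e
    refine (h.isLocalCohenMacaulay (M.comap e)).of_ringEquiv
      (Localization.localRingEquiv (M.comap e) M e rfl)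

theorem polynomial {T : Type*} [CommRing T] [IsNoetherianRing T] [IsJacobsonRing T] {d : ℕ}
    (h : IsEquicodimensionalCM T d) : IsEquicodimensionalCM (Polynomial T) (d + 1) where
  height_eq M _ := by
    have := Polynomial.isMaximal_comap_C_of_isJacobsonRing M
    have : M.LiesOver (M.comap (Polynomial.C : T →+* _)) := ⟨rfl⟩
    rw [Polynomial.height_eq_height_add_one (M.comap Polynomial.C) M, h.height_eq]
    norm_cast
  isLocalCohenMacaulay M _ := by
    have := Polynomial.isMaximal_comap_C_of_isJacobsonRing M
    exact .localization_polynomial M (h.isLocalCohenMacaulay _)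

theorem mvPolynomial {T : Type*} [CommRing T] [IsNoetherianRing T] [IsJacobsonRing T] {d : ℕ}
    (h : IsEquicodimensionalCM T d) (n : ℕ) :
    IsEquicodimensionalCM (MvPolynomial (Fin n) T) (d + n) := by
  induction n with
  | zero => exact h.of_ringEquiv (MvPolynomial.isEmptyRingEquiv T (Fin 0)).symm
  | succ n ih => exact ih.polynomial.of_ringEquiv (MvPolynomial.finSuccEquiv T n).toRingEquiv.symm

theorem localization {T : Type u} [CommRing T] [IsNoetherianRing T] {d : ℕ}
    (h : IsEquicodimensionalCM T d) (p : Ideal T) [p.IsPrime] :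
    IsLocalCohenMacaulay (Localization.AtPrime p) := by
  obtain ⟨M, hM, hle⟩ := Ideal.exists_le_maximal p (Ideal.IsPrime.ne_top ‹_›)
  let L := Localization.AtPrime M
  have disj : Disjoint (M.primeCompl : Set T) (p : Set T) :=
    Set.disjoint_compl_left_iff_subset.mpr hle
  have hunder := IsLocalization.under_map_of_isPrime_disjoint M.primeCompl L ‹p.IsPrime› disj
  have : (p.map (algebraMap T L)).IsPrime :=
    IsLocalization.isPrime_of_isPrime_disjoint M.primeCompl _ _ ‹_› disj
  let L' := Localization.AtPrime (p.map (algebraMap T L))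
  have : IsLocalization.AtPrime L' p := by
    convert IsLocalization.isLocalization_isLocalization_atPrime_isLocalization M.primeCompl
      L' (p.map (algebraMap T L))
    exact hunder.symm
  exact ((h.isLocalCohenMacaulay M).localization (p.map (algebraMap T L)) L').of_ringEquiv
    (IsLocalization.algEquiv p.primeCompl L' (Localization.AtPrime p)).toRingEquiv

/-- Localize at the preimage of `q`: the local ring of `B` is a quotient of a Cohen-Macaulay local
ring by a prime, where height and dimension of the quotient add up. -/
theorem height_ker_add {T B : Type u} [CommRing T] [IsNoetherianRing T] {d : ℕ}
    (h : IsEquicodimensionalCM T d) [CommRing B] [IsDomain B] (φ : T →+* B)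
    (hφ : Function.Surjective φ) (q : Ideal B) [q.IsPrime] :
    (RingHom.ker φ).height + q.height = (q.comap φ).height := by
  let p := q.comap φ
  let ψ := Localization.localRingHom p q φ rfl
  have hψ : Function.Surjective ψ := RingHom.surjective_localRingHom_of_surjective φ hφ q
  have : IsDomain (Localization.AtPrime q) :=
    IsLocalization.isDomain_localization q.primeCompl_le_nonZeroDivisors
  have : (RingHom.ker ψ).IsPrime := RingHom.ker_isPrime ψ
  have h1 := (h.localization p).height_add_ringKrullDim_quotient (RingHom.ker ψ)
  have h2 : (RingHom.ker ψ).under T = RingHom.ker φ := by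
    ext t
    rw [Ideal.mem_comap, RingHom.mem_ker, RingHom.mem_ker, Localization.localRingHom_to_map]
    exact IsLocalization.to_map_eq_zero_iff _ q.primeCompl_le_nonZeroDivisors
  rw [ringKrullDim_eq_of_ringEquiv (RingHom.quotientKerEquivOfSurjective hψ),
    IsLocalization.AtPrime.ringKrullDim_eq_height q, IsLocalization.AtPrime.ringKrullDim_eq_height p,
    ← IsLocalization.height_under p.primeCompl, h2] at h1
  exact_mod_cast h1

/-- Every maximal ideal of `B` has the same height `d - ht (ker φ)`, which is therefore `dim B`. -/
theorem height_ker_add_ringKrullDim {T B : Type u} [CommRing T] [IsNoetherianRing T] {d : ℕ}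
    (h : IsEquicodimensionalCM T d) [CommRing B] [IsDomain B] (φ : T →+* B)
    (hφ : Function.Surjective φ) :
    ((RingHom.ker φ).height : WithBot ℕ∞) + ringKrullDim B = d := by
  have hM : ∀ M : Ideal B, M.IsMaximal → (RingHom.ker φ).height + M.height = d := fun M _ => by
    have : (M.comap φ).IsMaximal := Ideal.comap_isMaximal_of_surjective φ hφ
    rw [h.height_ker_add φ hφ M, h.height_eq]
  have : (RingHom.ker φ).IsPrime := RingHom.ker_isPrime φ
  have hfin : (RingHom.ker φ).height ≠ ⊤ := Ideal.height_ne_top_of_isPrime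
  obtain ⟨M, hMm⟩ := Ideal.exists_maximal B
  have : (⨆ (I : Ideal B) (_ : I.IsMaximal), I.height) = M.height := by
    refine le_antisymm (iSup₂_le fun I hI => ?_) (le_iSup₂_of_le M hMm le_rfl)
    refine (ENat.add_le_add_iff_left hfin).mp ?_
    rw [hM I hI, hM M hMm]
  rw [← Ideal.sup_isMaximal_height_eq_ringKrullDim, this]
  exact_mod_cast hM M hMm

/-- The dimension formula in domains that are quotients of `T`. -/
theorem height_add_ringKrullDim_quotient {T B : Type u} [CommRing T] [IsNoetherianRing T] {d : ℕ}
    (h : IsEquicodimensionalCM T d) [CommRing B] [IsDomain B] (φ : T →+* B)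
    (hφ : Function.Surjective φ) (q : Ideal B) [q.IsPrime] :
    (q.height : WithBot ℕ∞) + ringKrullDim (B ⧸ q) = ringKrullDim B := by
  have h1 := h.height_ker_add φ hφ q
  have h2 := h.height_ker_add_ringKrullDim φ hφ
  have h3 := h.height_ker_add_ringKrullDim ((Ideal.Quotient.mk q).comp φ)
    (Ideal.Quotient.mk_surjective.comp hφ)
  rw [← RingHom.comap_ker, Ideal.mk_ker, ← h1, ← h2, WithBot.coe_add, add_assoc] at h3
  have : (RingHom.ker φ).IsPrime := RingHom.ker_isPrime φ
  obtain ⟨k, hk⟩ := ENat.ne_top_iff_exists.mp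
    (Ideal.height_ne_top_of_isPrime (I := RingHom.ker φ))
  rw [← hk] at h3
  exact ENat.WithBot.natCast_add_cancel.mp (by exact_mod_cast h3)

end IsEquicodimensionalCM

end Equicodimensional

/-! ### Primes of a local ring just below the maximal ideal -/

section PuncturedLocal

open IsLocalRing

theorem IsLocalRing.eq_maximalIdeal_of_forall_mem {D : Type*} [CommRing D] [IsDomain D]
    [IsNoetherianRing D] [IsLocalRing D] {h : D} (hh : h ≠ 0) (hm : h ∈ maximalIdeal D)
    (H : ∀ q : Ideal D, q.IsPrime → q ≠ ⊥ → h ∈ q) (q : Ideal D) [q.IsPrime] (hq : q ≠ ⊥) :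
    q = maximalIdeal D := by
  have key : (maximalIdeal D).height ≤ (1 : ℕ) := by
    have hs : Ideal.span {h} ≤ maximalIdeal D := by
      rwa [Ideal.span_singleton_le_iff_mem]
    by_cases hmin : maximalIdeal D ∈ (Ideal.span {h}).minimalPrimes
    · exact Ideal.height_le_one_of_isPrincipal_of_mem_minimalPrimes _ _ hmin
    -- If the maximal ideal were not minimal over `h`, avoid the minimal primes of `h` by some `x`.
    -- A minimal prime `P` of `x` has height at most one and contains `h`, so it strictly contains a
    -- prime minimal over `h`; that prime must be zero, contradicting `h ≠ 0`.
    exfalso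
    have hnot : ¬ ((maximalIdeal D : Set D) ⊆ ⋃ P ∈ (Ideal.span {h}).minimalPrimes, P) := by
      rw [Ideal.subset_union_prime_finite (Ideal.finite_minimalPrimes_of_isNoetherianRing D _) ⊥ ⊥
        fun P hP _ _ => hP.1.1]
      rintro ⟨P, hP, hle⟩
      have := hP.1.1
      rw [(IsLocalRing.le_maximalIdeal hP.1.1.ne_top).antisymm hle] at hP
      exact hmin hP
    obtain ⟨x, hxm, hx⟩ := Set.not_subset.mp hnot
    simp only [Set.mem_iUnion, not_exists] at hx
    obtain ⟨P0, hP0, -⟩ := Ideal.exists_minimalPrimes_le hs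
    obtain ⟨P, hP, -⟩ := Ideal.exists_minimalPrimes_le
      ((Ideal.span_singleton_le_iff_mem _).mpr hxm)
    have hxP : x ∈ P := hP.1.2 (Ideal.mem_span_singleton_self x)
    have hPp := hP.1.1
    have hP1 := Ideal.height_le_one_of_isPrincipal_of_mem_minimalPrimes _ _ hP
    have hhP : h ∈ P := H P hPp (by
      rintro rfl
      have hx0 : x = 0 := hxP
      exact hx P0 hP0 (hx0 ▸ P0.zero_mem))
    obtain ⟨P1, hP1m, hle⟩ := Ideal.exists_minimalPrimes_le
      ((Ideal.span_singleton_le_iff_mem _).mpr hhP)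
    have hP1p := hP1m.1.1
    have hne : P1 ≠ P := by
      rintro rfl
      exact hx _ hP1m hxP
    have h0 : P1.height = 0 := by
      have h1 : P.height ≤ (1 : ℕ) := by exact_mod_cast hP1
      have := Ideal.height_le_iff.mp h1 P1 hP1p (lt_of_le_of_ne hle hne)
      exact Order.lt_one_iff.mp (by exact_mod_cast this)
    rw [Ideal.height_eq_zero_iff_eq_bot] at h0
    have hP1h : h ∈ P1 := hP1m.1.2 (Ideal.mem_span_singleton_self h)
    rw [h0] at hP1h
    exact hh hP1h
  by_contra hne
  have := Ideal.height_le_iff.mp key q inferInstance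
    (lt_of_le_of_ne (IsLocalRing.le_maximalIdeal (Ideal.IsPrime.ne_top ‹_›)) hne)
  exact hq (Ideal.height_eq_zero_iff_eq_bot.mp (Order.lt_one_iff.mp (by exact_mod_cast this)))

theorem IsLocalRing.eq_maximalIdeal_of_lt {R : Type*} [CommRing R] [IsNoetherianRing R]
    [IsLocalRing R] (p : Ideal R) [p.IsPrime] {a : R} (ha : a ∈ maximalIdeal R) (hap : a ∉ p)
    (H : ∀ q : Ideal R, q.IsPrime → p < q → a ∈ q) (q : Ideal R) [q.IsPrime] (hq : p < q) :
    q = maximalIdeal R := by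
  have : IsLocalRing (R ⧸ p) := .of_surjective' _ Ideal.Quotient.mk_surjective
  have hm : (maximalIdeal (R ⧸ p)).comap (Ideal.Quotient.mk p) = maximalIdeal R :=
    IsLocalRing.eq_maximalIdeal
      (Ideal.comap_isMaximal_of_surjective _ Ideal.Quotient.mk_surjective)
  have hlt : ∀ q : Ideal (R ⧸ p), q ≠ ⊥ → p < q.comap (Ideal.Quotient.mk p) := fun q hq => by
    refine lt_of_le_of_ne (fun x hx => ?_) fun h => hq ?_
    · rw [Ideal.mem_comap, Ideal.Quotient.eq_zero_iff_mem.mpr hx]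
      exact q.zero_mem
    · rw [← Ideal.map_comap_of_surjective _ Ideal.Quotient.mk_surjective q, ← h,
        Ideal.map_quotient_self]
  have hqk : RingHom.ker (Ideal.Quotient.mk p) ≤ q := by rw [Ideal.mk_ker]; exact hq.le
  have hqp : (q.map (Ideal.Quotient.mk p)).IsPrime :=
    Ideal.map_isPrime_of_surjective Ideal.Quotient.mk_surjective hqk
  have hcm : (q.map (Ideal.Quotient.mk p)).comap (Ideal.Quotient.mk p) = q := by
    rw [Ideal.comap_map_of_surjective' _ Ideal.Quotient.mk_surjective, sup_eq_left]
    exact hqk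
  have key := IsLocalRing.eq_maximalIdeal_of_forall_mem (D := R ⧸ p) (h := Ideal.Quotient.mk p a)
    (by rwa [Ne, Ideal.Quotient.eq_zero_iff_mem])
    (by rw [← Ideal.mem_comap, hm]; exact ha)
    (fun q' hq' hne => H _ inferInstance (hlt q' hne)) (q.map (Ideal.Quotient.mk p)) (by
      intro h
      rw [h, ← RingHom.ker_eq_comap_bot, Ideal.mk_ker] at hcm
      exact hq.ne hcm)
  rw [← hcm, key]
  exact hm

theorem IsLocalRing.ringKrullDim_quotient_eq_one {R : Type*} [CommRing R] [IsNoetherianRing R]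
    [IsLocalRing R] (p : Ideal R) [p.IsPrime] (hp : p ≠ maximalIdeal R)
    (H : ∀ q : Ideal R, q.IsPrime → p < q → q = maximalIdeal R) :
    ringKrullDim (R ⧸ p) = 1 := by
  have hlt := lt_of_le_of_ne (IsLocalRing.le_maximalIdeal (Ideal.IsPrime.ne_top ‹p.IsPrime›)) hp
  apply le_antisymm
  · rw [ringKrullDim_quotient]
    have : Order.krullDim (PrimeSpectrum.zeroLocus (p : Set R)) ≤ (1 : ℕ) := by
      refine iSup_le fun l => ?_
      by_contra! hl
      have hl2 : 2 ≤ l.length := by exact_mod_cast hl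
      have h1 : l ⟨0, by omega⟩ < l ⟨1, by omega⟩ := l.strictMono (Fin.mk_lt_mk.mpr zero_lt_one)
      have h2 : l ⟨1, by omega⟩ < l ⟨2, by omega⟩ := l.strictMono (Fin.mk_lt_mk.mpr one_lt_two)
      have e1 := H (l ⟨1, by omega⟩).1.asIdeal inferInstance
        (lt_of_le_of_lt ((PrimeSpectrum.mem_zeroLocus _ _).mp (l ⟨0, by omega⟩).2) h1)
      have h2' : (l ⟨1, by omega⟩).1.asIdeal < (l ⟨2, by omega⟩).1.asIdeal := h2
      rw [e1] at h2'
      exact h2'.not_ge (IsLocalRing.le_maximalIdeal (Ideal.IsPrime.ne_top inferInstance))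
    exact_mod_cast this
  · have : IsLocalRing (R ⧸ p) := .of_surjective' _ Ideal.Quotient.mk_surjective
    obtain ⟨x, hx, hxp⟩ := SetLike.exists_of_lt hlt
    have h := ringKrullDim_succ_le_of_surjective (Ideal.Quotient.factor hlt.le)
      (Ideal.Quotient.factor_surjective hlt.le) (r := Ideal.Quotient.mk p x)
      (mem_nonZeroDivisors_of_ne_zero (by rwa [Ne, Ideal.Quotient.eq_zero_iff_mem]))
      (by rwa [Ideal.Quotient.factor_mk, Ideal.Quotient.eq_zero_iff_mem])
    refine le_trans ?_ h
    exact le_add_of_nonneg_left ringKrullDim_nonneg_of_nontrivial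

end PuncturedLocal

/-! ### Inverting one element of the maximal ideal -/

section PuncturedLocalization

open IsLocalRing

theorem IsLocalization.Away.disjoint_powers_of_notMem {R : Type*} [CommRing R] {f : R}
    {q : Ideal R} [q.IsPrime] (hq : f ∉ q) :
    Disjoint (Submonoid.powers f : Set R) (q : Set R) := by
  rw [Set.disjoint_left]
  rintro _ ⟨n, rfl⟩ hn
  exact hq (Ideal.IsPrime.mem_of_pow_mem ‹_› n hn)

variable {R : Type u} [CommRing R] {f : R} (S : Type u) [CommRing S] [Algebra R S]
  [IsLocalization.Away f S]

include f in
theorem IsLocalization.Away.notMem_under (M : Ideal S) [M.IsPrime] : f ∉ M.under R := fun h =>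
  Ideal.IsPrime.ne_top ‹M.IsPrime› (Ideal.eq_top_of_isUnit_mem _ h
    (IsLocalization.Away.algebraMap_isUnit f))

/-- A prime of `S = R[1/f]` strictly below `q S`, for a prime `q` of `R` not containing `f`. -/
theorem IsLocalization.Away.exists_isPrime_lt (M : Ideal S) {q : Ideal R} [q.IsPrime]
    (hq : M.under R < q) (hf : f ∉ q) :
    ∃ N : Ideal S, N.IsPrime ∧ M < N ∧ N.under R = q := by
  have disj := IsLocalization.Away.disjoint_powers_of_notMem hf
  have hunder := IsLocalization.under_map_of_isPrime_disjoint (Submonoid.powers f) S ‹q.IsPrime›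
    disj
  refine ⟨q.map (algebraMap R S), IsLocalization.isPrime_of_isPrime_disjoint (Submonoid.powers f) _
    _ ‹_› disj, lt_of_le_of_ne ?_ ?_, hunder⟩
  · rw [← IsLocalization.map_under (Submonoid.powers f) S M]
    exact Ideal.map_mono hq.le
  · rintro rfl
    exact hq.ne hunder

variable [IsLocalRing R] [IsNoetherianRing R]

/-- Inverting an element of the maximal ideal of a noetherian local ring gives a Jacobson ring. -/
theorem IsLocalization.Away.isJacobsonRing_of_mem_maximalIdeal (hfm : f ∈ maximalIdeal R) :
    IsJacobsonRing S := by
  have : IsNoetherianRing S := IsLocalization.isNoetherianRing (Submonoid.powers f) S inferInstance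
  rw [isJacobsonRing_iff_prime_eq]
  intro P hP
  rw [Ideal.eq_jacobson_iff_notMem]
  intro x hx
  -- A prime over `P` maximal among those missing `x` is shown to be a maximal ideal. Writing `x` as
  -- `a` over a power of `f`, every prime of `R` strictly above its contraction contains `a * f`, so
  -- is the maximal ideal; that one contains `f` and is invisible in `S`.
  obtain ⟨P', ⟨hP'p, hPP', hxP'⟩, hmax⟩ : ∃ P' : Ideal S, (P'.IsPrime ∧ P ≤ P' ∧ x ∉ P') ∧
      ∀ I : Ideal S, (I.IsPrime ∧ P ≤ I ∧ x ∉ I) → ¬ P' < I := set_has_maximal_iff_noetherian.mpr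
    (inferInstance : IsNoetherian S S) {I : Ideal S | I.IsPrime ∧ P ≤ I ∧ x ∉ I}
    ⟨P, hP, le_rfl, hx⟩
  refine ⟨P', ⟨hPP', ?_⟩, hxP'⟩
  obtain ⟨⟨a, s⟩, has⟩ := IsLocalization.surj (Submonoid.powers f) x
  have hs : IsUnit (algebraMap R S s) := IsLocalization.map_units S s
  have hmem : ∀ I : Ideal S, x ∈ I ↔ a ∈ I.under R := fun I => by
    rw [Ideal.mem_comap, ← has, Ideal.mul_unit_mem_iff_mem I hs]
  have hfP' := IsLocalization.Away.notMem_under (f := f) S P'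
  have haP' : a ∉ P'.under R := (hmem P').not.mp hxP'
  have hbig := IsLocalRing.eq_maximalIdeal_of_lt (P'.under R) (a := a * f)
    (Ideal.mul_mem_left _ _ hfm)
    (fun h => (Ideal.IsPrime.mem_or_mem inferInstance h).elim haP' hfP') (fun q hq hlt => by
      by_contra hcon
      have hfq : f ∉ q := fun h => hcon (Ideal.mul_mem_left _ _ h)
      obtain ⟨N, hN, hlt', hNq⟩ := IsLocalization.Away.exists_isPrime_lt S P' hlt hfq
      refine hmax N ⟨hN, hPP'.trans hlt'.le, fun hxN => hcon ?_⟩ hlt'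
      exact Ideal.mul_mem_right _ _ (hNq ▸ (hmem N).mp hxN))
  obtain ⟨N, hN, hle⟩ := Ideal.exists_le_maximal P' hP'p.ne_top
  obtain rfl | hlt := hle.eq_or_lt
  · exact hN
  · exfalso
    have hNp := hN.isPrime
    have hlt2 : P'.under R < N.under R := by
      refine lt_of_le_of_ne (Ideal.comap_mono hle) fun h => hlt.ne ?_
      rw [← IsLocalization.map_under (Submonoid.powers f) S P', h,
        IsLocalization.map_under (Submonoid.powers f) S N]
    refine IsLocalization.Away.notMem_under (f := f) S N ?_
    rw [hbig _ hlt2]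
    exact hfm

/-- Inverting an element of the maximal ideal of a Cohen-Macaulay local ring gives an
equicodimensional Cohen-Macaulay ring. -/
theorem IsLocalCohenMacaulay.exists_isEquicodimensionalCM_away (h : IsLocalCohenMacaulay R)
    (hfm : f ∈ maximalIdeal R) : ∃ d : ℕ, IsEquicodimensionalCM S d := by
  obtain ⟨n, hn⟩ := exists_ringKrullDim_eq_natCast R ringKrullDim_lt_top
  -- The contraction of a maximal ideal of `S` has one-dimensional quotient. If `S` has a maximal
  -- ideal then `n ≥ 1`; otherwise the truncated subtraction is harmless.
  refine ⟨n - 1, fun M _ => ?_, fun M _ => ?_⟩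
  · have hfM := IsLocalization.Away.notMem_under (f := f) S M
    have hdim := IsLocalRing.ringKrullDim_quotient_eq_one (M.under R)
      (fun h => hfM (by rw [h]; exact hfm))
      fun q hq hlt => IsLocalRing.eq_maximalIdeal_of_lt (M.under R) hfm hfM (fun q hq hlt => by
        by_contra hfq
        obtain ⟨N, hN, hlt', -⟩ := IsLocalization.Away.exists_isPrime_lt S M hlt hfq
        exact hN.ne_top (‹M.IsMaximal›.out.2 N hlt')) q hlt
    have key := h.height_add_ringKrullDim_quotient (M.under R)
    rw [hdim, hn, IsLocalization.height_under (Submonoid.powers f)] at key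
    have key' : M.height + 1 = (n : ℕ∞) := by exact_mod_cast key
    obtain ⟨k, hk⟩ := ENat.ne_top_iff_exists.mp (show M.height ≠ ⊤ by
      intro h
      rw [h, top_add] at key'
      exact ENat.top_ne_natCast n key')
    rw [← hk] at key' ⊢
    have : k + 1 = n := by exact_mod_cast key'
    subst this
    rfl
  · have : IsLocalization.AtPrime (Localization.AtPrime M) (M.under R) :=
      IsLocalization.isLocalization_isLocalization_atPrime_isLocalization (Submonoid.powers f) _ M
    exact h.localization (M.under R) _

end PuncturedLocalization

/-! ### The dimension formula on affine charts -/

section CompleteLocal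

open IsLocalRing

variable (R : Type u) [CommRing R] [IsLocalRing R] [IsNoetherianRing R]
  {B : Type u} [CommRing B] [Algebra R B] [Algebra.FiniteType R B] {g : R}

theorem isJacobsonRing_of_finiteType_of_isUnit (hg : g ∈ maximalIdeal R)
    (hu : IsUnit (algebraMap R B g)) : IsJacobsonRing B := by
  let S := Localization.Away g
  have hS : IsJacobsonRing S := IsLocalization.Away.isJacobsonRing_of_mem_maximalIdeal S hg
  let := (IsLocalization.Away.lift (S := S) g hu).toAlgebra
  have : IsScalarTower R S B := .of_algebraMap_eq fun r =>
    (IsLocalization.Away.lift_eq g hu r).symm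
  have : Algebra.FiniteType S B := .of_restrictScalars_finiteType R S B
  exact isJacobsonRing_of_finiteType (A := S)

/-- No map between `R` and `S` is needed: generators of `B` over `R` still generate over `S` once
the image of `S` contains that of `R`. -/
theorem MvPolynomial.eval₂Hom_surjective_of_range_le {R S B : Type*} [CommRing R] [CommRing S]
    [CommRing B] [Algebra R B] {n : ℕ} {φ : MvPolynomial (Fin n) R →ₐ[R] B}
    (hφ : Function.Surjective φ) (θ : S →+* B) (hθ : ∀ r : R, algebraMap R B r ∈ θ.range) :
    Function.Surjective (MvPolynomial.eval₂Hom θ fun i => φ (MvPolynomial.X i)) := by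
  rw [← RingHom.range_eq_top, eq_top_iff]
  intro b _
  obtain ⟨P, rfl⟩ := hφ b
  induction P using MvPolynomial.induction_on with
  | C r =>
    obtain ⟨s, hs⟩ := hθ r
    refine ⟨MvPolynomial.C s, ?_⟩
    rw [MvPolynomial.coe_eval₂Hom, MvPolynomial.eval₂_C, hs]
    exact (φ.commutes r).symm
  | add p q hp hq => rw [map_add]; exact add_mem (hp trivial) (hq trivial)
  | mul_X p i hp =>
    rw [map_mul]
    exact mul_mem (hp trivial) ⟨MvPolynomial.X i, by simp⟩

/-- The dimension formula for domains of finite type over a complete local ring in which some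
element of the maximal ideal is inverted. -/
theorem height_add_ringKrullDim_quotient_of_finiteType_of_isUnit
    [IsAdicComplete (maximalIdeal R) R] [IsDomain B] (hg : g ∈ maximalIdeal R)
    (hu : IsUnit (algebraMap R B g)) (q : Ideal B) [q.IsPrime] :
    (q.height : WithBot ℕ∞) + ringKrullDim (B ⧸ q) = ringKrullDim B := by
  let p := RingHom.ker (algebraMap R B)
  have : p.IsPrime := RingHom.ker_isPrime _
  have : IsLocalRing (R ⧸ p) := .of_surjective' _ Ideal.Quotient.mk_surjective
  have := IsLocalRing.isAdicComplete_quotient R p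
  obtain ⟨Q, _, _, _, ψ, hQ, hψ⟩ := exists_surjective_isLocalCohenMacaulay (R ⧸ p)
  let κ : R ⧸ p →+* B := RingHom.kerLift (algebraMap R B)
  obtain ⟨f, hf⟩ := hψ (Ideal.Quotient.mk p g)
  have hfm : f ∈ maximalIdeal Q := by
    by_contra hfu
    rw [notMem_maximalIdeal] at hfu
    have h1 : IsUnit (Ideal.Quotient.mk p g) := hf ▸ hfu.map ψ
    have hm : (maximalIdeal (R ⧸ p)).comap (Ideal.Quotient.mk p) = maximalIdeal R :=
      IsLocalRing.eq_maximalIdeal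
        (Ideal.comap_isMaximal_of_surjective _ Ideal.Quotient.mk_surjective)
    rw [← hm, Ideal.mem_comap, mem_maximalIdeal] at hg
    exact hg h1
  have hfu : IsUnit ((κ.comp ψ) f) := by
    rw [RingHom.comp_apply, hf]
    exact hu
  let S := Localization.Away f
  have hS : IsJacobsonRing S := IsLocalization.Away.isJacobsonRing_of_mem_maximalIdeal S hfm
  obtain ⟨d, hd⟩ := hQ.exists_isEquicodimensionalCM_away S hfm
  let θ : S →+* B := IsLocalization.Away.lift f hfu
  obtain ⟨n, φ, hφ⟩ := Algebra.FiniteType.iff_quotient_mvPolynomial''.mp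
    (inferInstance : Algebra.FiniteType R B)
  have : IsNoetherianRing S := IsLocalization.isNoetherianRing (Submonoid.powers f) S inferInstance
  refine (hd.mvPolynomial n).height_add_ringKrullDim_quotient _
    (MvPolynomial.eval₂Hom_surjective_of_range_le hφ θ fun r => ?_) q
  obtain ⟨s, hs⟩ := hψ (Ideal.Quotient.mk p r)
  refine ⟨algebraMap Q S s, ?_⟩
  rw [IsLocalization.Away.lift_eq, RingHom.comp_apply, hs]
  rfl

end CompleteLocal

/-! ### Additivity of heights in posets and its gluing -/

section OrderCatenary

open Order

/-- In the poset `P`, heights are additive along intervals. -/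
def HeightAdditive (P : Type*) [PartialOrder P] : Prop :=
  ∀ ⦃Z Y : P⦄, Z ≤ Y → (height Z : WithBot ℕ∞) + krullDim (Set.Icc Z Y) = height Y

theorem LTSeries.length_le_krullDim_Icc {P : Type*} [PartialOrder P] (p : LTSeries P) {Z Y : P}
    (hZ : Z ≤ p.head) (hY : p.last ≤ Y) : (p.length : WithBot ℕ∞) ≤ krullDim (Set.Icc Z Y) :=
  LTSeries.length_le_krullDim
    { length := p.length
      toFun := fun i => ⟨p i, hZ.trans (p.monotone (Fin.zero_le i)),
        (p.monotone (Fin.le_last i)).trans hY⟩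
      step := fun i => p.step i : LTSeries (Set.Icc Z Y) }

/-- An order isomorphism restricts to intervals. -/
def OrderIso.iccCongr {P P' : Type*} [PartialOrder P] [PartialOrder P'] (e : P ≃o P') (Z Y : P) :
    Set.Icc Z Y ≃o Set.Icc (e Z) (e Y) where
  toFun x := ⟨e x, e.monotone x.2.1, e.monotone x.2.2⟩
  invFun x := ⟨e.symm x, e.le_symm_apply.mpr x.2.1, e.symm_apply_le.mpr x.2.2⟩
  left_inv _ := Subtype.ext (e.symm_apply_apply _)
  right_inv _ := Subtype.ext (e.apply_symm_apply _)
  map_rel_iff' := e.le_iff_le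

/-- Intervals in an upper set are intervals in the ambient poset. -/
def IsUpperSet.orderIsoIcc {P : Type*} [PartialOrder P] {U : Set P} (hU : IsUpperSet U)
    (Z Y : U) : Set.Icc Z Y ≃o Set.Icc (Z : P) Y where
  toFun x := ⟨x.1.1, x.2.1, x.2.2⟩
  invFun x := ⟨⟨x.1, hU x.2.1 Z.2⟩, x.2.1, x.2.2⟩
  left_inv _ := rfl
  right_inv _ := rfl
  map_rel_iff' := Iff.rfl

theorem HeightAdditive.of_orderIso {P P' : Type*} [PartialOrder P] [PartialOrder P'] (e : P ≃o P')
    (h : HeightAdditive P') : HeightAdditive P := fun Z Y hZY => by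
  rw [← height_orderIso e, ← height_orderIso e Y, krullDim_eq_of_orderIso (e.iccCongr Z Y)]
  exact h (e.monotone hZY)

variable {P ι : Type*} [PartialOrder P] {U : ι → Set P}

/-- A chain below `Y` can be extended down to a minimal element, so it lies in one `U k`. Inside a
chart, the interval from any minimal element to `Y` realizes the height; a minimal element common to
`U i` and `U k` identifies the two heights. -/
theorem height_eq_height_of_cover (hU : ∀ i, IsUpperSet (U i)) (hcov : ∀ Z, ∃ i, Z ∈ U i)
    (hmin : ∀ i j Y, Y ∈ U i → Y ∈ U j → ∃ w ≤ Y, IsMin w ∧ w ∈ U i ∧ w ∈ U j)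
    (hF : ∀ i, HeightAdditive (U i)) {i : ι} (Y : U i) : height (Y : P) = height Y := by
  have hw : ∀ (j : ι) (Y w : U j), w ≤ Y → IsMin (w : P) →
      krullDim (Set.Icc (w : P) Y) = height Y := fun j Y w hwY hw => by
    have h0 : height w = 0 := height_eq_zero.mpr fun v hv => hw hv
    rw [← hF j hwY, h0, krullDim_eq_of_orderIso ((hU j).orderIsoIcc w Y)]
    exact (zero_add _).symm
  apply le_antisymm
  · refine height_le fun p hp => ?_
    obtain ⟨k, hk⟩ := hcov p.head
    obtain ⟨w, hwp, hwm, hwk, -⟩ := hmin k k _ hk hk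
    have hYk : (Y : P) ∈ U k := hU k ((hwp.trans (p.monotone (Fin.zero_le _))).trans hp.le) hwk
    obtain ⟨v, hvY, hvm, hvi, hvk⟩ := hmin i k Y Y.2 hYk
    have h1 := p.length_le_krullDim_Icc hwp hp.le
    rw [hw k ⟨Y, hYk⟩ ⟨w, hwk⟩ ((hwp.trans (p.monotone (Fin.zero_le _))).trans hp.le) hwm,
      ← hw k ⟨Y, hYk⟩ ⟨v, hvk⟩ hvY hvm, hw i Y ⟨v, hvi⟩ hvY hvm] at h1
    exact_mod_cast h1
  · exact height_le_height_apply_of_strictMono _ (Subtype.strictMono_coe _) Y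

/-- Additivity of heights can be checked on a cover by upper sets, provided that there are
sufficiently many minimal elements. -/
theorem HeightAdditive.of_cover (hU : ∀ i, IsUpperSet (U i)) (hcov : ∀ Z, ∃ i, Z ∈ U i)
    (hmin : ∀ i j Y, Y ∈ U i → Y ∈ U j → ∃ w ≤ Y, IsMin w ∧ w ∈ U i ∧ w ∈ U j)
    (hF : ∀ i, HeightAdditive (U i)) : HeightAdditive P := fun Z Y hZY => by
  obtain ⟨i, hi⟩ := hcov Z
  have h := hF i (show (⟨Z, hi⟩ : U i) ≤ ⟨Y, hU i hZY hi⟩ from hZY)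
  rwa [← height_eq_height_of_cover hU hcov hmin hF, ← height_eq_height_of_cover hU hcov hmin hF,
    krullDim_eq_of_orderIso ((hU i).orderIsoIcc _ _)] at h

/-- If all maximal elements have the same height and heights are additive, then
`height Z + coheight Z` is the dimension. -/
theorem HeightAdditive.height_add_coheight (h : HeightAdditive P)
    (hmax : ∀ Z : P, ∃ Y, Z ≤ Y ∧ IsMax Y)
    (heq : ∀ Y Y' : P, IsMax Y → IsMax Y' → height Y = height Y') (Z : P) :
    (height Z : WithBot ℕ∞) + coheight Z = krullDim P := by
  obtain ⟨Y, hZY, hY⟩ := hmax Z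
  have : Nonempty P := ⟨Z⟩
  have hdim : krullDim P = height Y := by
    refine le_antisymm ?_ (height_le_krullDim Y)
    rw [krullDim_eq_iSup_height_of_nonempty, WithBot.coe_le_coe]
    refine iSup_le fun W => ?_
    obtain ⟨Y', hWY', hY'⟩ := hmax W
    rw [heq Y Y' hY hY']
    exact height_mono hWY'
  rw [hdim]
  rcases eq_or_ne (height Z) ⊤ with htop | hne
  · have h1 : height Y = ⊤ := top_le_iff.mp (htop ▸ height_mono hZY)
    rw [htop, h1]
    exact_mod_cast top_add _
  obtain ⟨n, hn⟩ := ENat.ne_top_iff_exists.mp hne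
  rw [← h hZY]
  congr 1
  apply le_antisymm
  · rw [coheight_eq_krullDim_Ici]
    refine iSup_le fun p => ?_
    obtain ⟨Y', hY', hm⟩ := hmax p.last.1
    have hZY' : Z ≤ Y' := le_trans p.last.2 hY'
    have h1 := h hZY'
    rw [← heq Y Y' hY hm, ← h hZY, ← hn] at h1
    -- Maximal elements have equal height, so cancelling the finite height of `Z` makes every
    -- interval from `Z` to a maximal element equally long.
    have h2 : krullDim (Set.Icc Z Y') = krullDim (Set.Icc Z Y) :=
      (ENat.WithBot.natCast_add_cancel (c := n)).mp (by exact_mod_cast h1)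
    rw [← h2]
    exact (p.map Subtype.val (Subtype.strictMono_coe _)).length_le_krullDim_Icc p.head.2 hY'
  · rw [coheight_eq_krullDim_Ici]
    exact krullDim_le_of_strictMono (fun x => (⟨x, x.2.1⟩ : Set.Ici Z)) fun _ _ h => h

end OrderCatenary

/-! ### From prime ideals to irreducible closed subsets -/

section Chart

open Order IsLocalRing

/-- In the reversed order the height of `q` is `dim B ⧸ q`, and the interval between `q` and `Q` has
dimension the height of `q ⧸ Q` in `B ⧸ Q`. -/
theorem HeightAdditive.primeSpectrum_orderDual {B : Type*} [CommRing B]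
    (h : ∀ (Q : Ideal B) [Q.IsPrime] (q : Ideal (B ⧸ Q)) [q.IsPrime],
      (q.height : WithBot ℕ∞) + ringKrullDim ((B ⧸ Q) ⧸ q) = ringKrullDim (B ⧸ Q)) :
    HeightAdditive (PrimeSpectrum B)ᵒᵈ := by
  intro Z Y hZY
  obtain ⟨q, rfl⟩ := OrderDual.toDual.surjective Z
  obtain ⟨Q, rfl⟩ := OrderDual.toDual.surjective Y
  have hQq : Q ≤ q := hZY
  let e := Q.asIdeal.primeSpectrumQuotientOrderIsoZeroLocus
  obtain ⟨q', hq'⟩ := e.surjective ⟨q, hQq⟩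
  have hcomap : q'.asIdeal.comap (Ideal.Quotient.mk Q.asIdeal) = q.asIdeal :=
    congrArg (fun x => x.1.asIdeal) hq'
  have h1 := h Q.asIdeal q'.asIdeal
  have h2 : ringKrullDim ((B ⧸ Q.asIdeal) ⧸ q'.asIdeal) = ringKrullDim (B ⧸ q.asIdeal) := by
    refine ringKrullDim_eq_of_ringEquiv (RingEquiv.symm ((Ideal.quotEquivOfEq ?_).trans
      (RingHom.quotientKerEquivOfSurjective (f := (Ideal.Quotient.mk q'.asIdeal).comp
        (Ideal.Quotient.mk Q.asIdeal))
        (Ideal.Quotient.mk_surjective.comp Ideal.Quotient.mk_surjective))))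
    rw [← RingHom.comap_ker, Ideal.mk_ker, hcomap]
  have h3 : (q'.asIdeal.height : WithBot ℕ∞) =
      krullDim (Set.Icc (OrderDual.toDual q) (OrderDual.toDual Q)) := by
    rw [PrimeSpectrum.height_eq_orderHeight, ← height_orderIso e, hq', height_eq_krullDim_Iic]
    rw [← krullDim_orderDual]
    refine krullDim_eq_of_orderIso (OrderIso.symm
      { toFun := fun x => OrderDual.toDual ⟨⟨OrderDual.ofDual x.1, x.2.2⟩, x.2.1⟩
        invFun := fun x => ⟨OrderDual.toDual (OrderDual.ofDual x).1.1,
          (OrderDual.ofDual x).2, (OrderDual.ofDual x).1.2⟩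
        left_inv := fun _ => rfl
        right_inv := fun _ => rfl
        map_rel_iff' := Iff.rfl })
  rw [h2, h3, PrimeSpectrum.ringKrullDim_quotient_eq_coheight,
    PrimeSpectrum.ringKrullDim_quotient_eq_coheight, add_comm] at h1
  rw [height_toDual, height_toDual]
  exact h1

theorem HeightAdditive.irreducibleCloseds_primeSpectrum (R : Type u) [CommRing R] [IsLocalRing R]
    [IsNoetherianRing R] [IsAdicComplete (maximalIdeal R) R] {B : Type u} [CommRing B] [Algebra R B]
    [Algebra.FiniteType R B] {g : R} (hg : g ∈ maximalIdeal R) (hu : IsUnit (algebraMap R B g)) :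
    HeightAdditive (IrreducibleCloseds (PrimeSpectrum B)) := by
  refine .of_orderIso ((OrderIso.dualDual _).trans
    (PrimeSpectrum.pointsEquivIrreducibleCloseds B).symm.dual) ?_
  refine .primeSpectrum_orderDual fun Q _ q _ => ?_
  exact height_add_ringKrullDim_quotient_of_finiteType_of_isUnit R hg
    (by rw [IsScalarTower.algebraMap_apply R B (B ⧸ Q)]; exact hu.map _) q

end Chart

/-! ### Topological dimension, Jacobson spaces and open covers -/

section Topological

open Order

variable {X : Type*} [TopologicalSpace X]

/-- The dimension of an irreducible closed subset is its height in the poset of all irreducible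
closed subsets. -/
theorem TopologicalSpace.IrreducibleCloseds.topologicalKrullDim_eq_height
    (Z : IrreducibleCloseds X) :
    topologicalKrullDim (Z : Set X) = ((height Z : ℕ∞) : WithBot ℕ∞) := by
  rw [height_eq_krullDim_Iic]
  have hind : Topology.IsInducing (Subtype.val : ((Z : Set X) : Type _) → X) := .subtypeVal
  apply le_antisymm
  · refine krullDim_le_of_strictMono (fun T => (⟨IrreducibleCloseds.map _ hind.continuous T, ?_⟩ :
      Set.Iic Z)) fun _ _ h => IrreducibleCloseds.map_strictMono_of_isInducing hind h
    refine (closure_mono ?_).trans Z.isClosed.closure_eq.subset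
    rintro _ ⟨x, -, rfl⟩
    exact x.2
  · have hpre : ∀ Y : IrreducibleCloseds X, Y ≤ Z →
        IsIrreducible (Subtype.val ⁻¹' (Y : Set X) : Set ((Z : Set X) : Type _)) := fun Y hY => by
      refine ⟨?_, ?_⟩
      · obtain ⟨y, hy⟩ := Y.isIrreducible.nonempty
        exact ⟨⟨y, hY hy⟩, hy⟩
      · rintro _ _ ⟨u, hu, rfl⟩ ⟨v, hv, rfl⟩ ⟨a, ha, hau⟩ ⟨b, hb, hbv⟩
        obtain ⟨c, hc, hcu⟩ := Y.isIrreducible.isPreirreducible u v hu hv ⟨a, ha, hau⟩ ⟨b, hb, hbv⟩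
        exact ⟨⟨c, hY hc⟩, hc, hcu⟩
    refine krullDim_le_of_strictMono (fun Y : Set.Iic Z => (⟨_, hpre Y.1 Y.2,
      Y.1.isClosed.preimage continuous_subtype_val⟩ : IrreducibleCloseds ((Z : Set X) : Type _))) ?_
    intro Y Y' h
    refine lt_of_le_of_ne (fun x hx => h.le hx) fun heq => h.not_ge fun y hy => ?_
    have : (⟨y, Y'.2 hy⟩ : (Z : Set X)) ∈ (Subtype.val ⁻¹' (Y'.1 : Set X) : Set ((Z : Set X) : Type _)) := hy
    exact (SetLike.ext_iff.mp heq ⟨y, Y'.2 hy⟩).mpr this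

theorem TopologicalSpace.IrreducibleCloseds.mem_irreducibleComponents_iff
    (Z : IrreducibleCloseds X) : (Z : Set X) ∈ irreducibleComponents X ↔ IsMax Z := by
  refine ⟨fun h Y hY => h.2 Y.isIrreducible hY, fun h => ⟨Z.isIrreducible, fun T hT hZT => ?_⟩⟩
  exact subset_closure.trans (h (b := ⟨closure T, hT.closure, isClosed_closure⟩)
    (hZT.trans subset_closure))

theorem HeightAdditive.dimensionFormulaHolds (h : HeightAdditive (IrreducibleCloseds X))
    (hX : IsEquidimensionalSpace X) : DimensionFormulaHolds X := by
  intro Z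
  rw [Z.topologicalKrullDim_eq_height]
  refine h.height_add_coheight (fun Z => ?_) (fun Y Y' hY hY' => ?_) Z
  · obtain ⟨u, hu, hZu⟩ := exists_mem_irreducibleComponents_subset_of_isIrreducible (Z : Set X)
      Z.isIrreducible
    let Y : IrreducibleCloseds X := ⟨u, hu.1, isClosed_of_mem_irreducibleComponents u hu⟩
    exact ⟨Y, hZu, Y.mem_irreducibleComponents_iff.mp hu⟩
  · have := hX Y (Y.mem_irreducibleComponents_iff.mpr hY) Y' (Y'.mem_irreducibleComponents_iff.mpr hY')
    rw [Y.topologicalKrullDim_eq_height, Y'.topologicalKrullDim_eq_height] at this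
    exact_mod_cast this

theorem JacobsonSpace.of_cover {ι : Type*} {W : ι → Type*} [∀ i, TopologicalSpace (W i)]
    (j : ∀ i, W i → X) (hj : ∀ i, Topology.IsOpenEmbedding (j i))
    (hcov : ∀ x, ∃ i, x ∈ Set.range (j i)) (hW : ∀ i, JacobsonSpace (W i)) : JacobsonSpace X := by
  let U : ι → Opens X := fun i => ⟨Set.range (j i), (hj i).isOpen_range⟩
  have hU : IsOpenCover U := by
    rw [IsOpenCover, eq_top_iff]
    intro x _
    exact Opens.mem_iSup.mpr (hcov x)
  refine hU.jacobsonSpace_iff.mpr fun i => ?_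
  have := hW i
  exact JacobsonSpace.of_isOpenEmbedding (hj i).toHomeomorph.symm.isOpenEmbedding

/-- The charts become the upper sets of irreducible closed subsets meeting them. By irreducibility
`Y` meets the intersection of two charts if it meets each, and the Jacobson property puts a closed
point of `X` there, which is the required minimal element. -/
theorem HeightAdditive.of_openCover [JacobsonSpace X] {ι : Type*} {W : ι → Type*}
    [∀ i, TopologicalSpace (W i)] (j : ∀ i, W i → X) (hj : ∀ i, Topology.IsOpenEmbedding (j i))
    (hcov : ∀ x, ∃ i, x ∈ Set.range (j i)) (hW : ∀ i, HeightAdditive (IrreducibleCloseds (W i))) :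
    HeightAdditive (IrreducibleCloseds X) := by
  refine .of_cover (U := fun i => {V : IrreducibleCloseds X | (j i ⁻¹' V).Nonempty})
    (fun i Y Y' hle hY => hY.mono (Set.preimage_mono hle)) (fun Z => ?_) (fun i k Y hi hk => ?_)
    fun i => .of_orderIso (IrreducibleCloseds.orderIsoOfIsOpenEmbedding _ (hj i)).symm (hW i)
  · obtain ⟨z, hz⟩ := Z.isIrreducible.nonempty
    obtain ⟨i, w, rfl⟩ := hcov z
    exact ⟨i, w, hz⟩
  · obtain ⟨a, ha⟩ := hi
    obtain ⟨b, hb⟩ := hk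
    have hne := Y.isIrreducible.isPreirreducible _ _ (hj i).isOpen_range (hj k).isOpen_range
      ⟨j i a, ha, a, rfl⟩ ⟨j k b, hb, b, rfl⟩
    obtain ⟨x, ⟨hxY, ⟨v, hv⟩, ⟨w, hw⟩⟩, hx⟩ := nonempty_inter_closedPoints hne
      (Y.isClosed.isLocallyClosed.inter
        ((hj i).isOpen_range.inter (hj k).isOpen_range).isLocallyClosed)
    refine ⟨⟨{x}, isIrreducible_singleton, hx⟩, Set.singleton_subset_iff.mpr hxY, ?_, ⟨v, hv⟩,
      ⟨w, hw⟩⟩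
    intro T hT
    obtain ⟨t, ht⟩ := T.isIrreducible.nonempty
    have htx : t = x := hT ht
    exact Set.singleton_subset_iff.mpr (htx ▸ ht)

end Topological

/-! ### Charts of schemes over the punctured spectrum -/

section Schemes

open IsLocalRing

/-- Affine charts on which some element of the maximal ideal is invertible. -/
theorem exists_chart_isUnit (R : Type u) [CommRing R] [IsLocalRing R] (X : Scheme.{u})
    (f : X ⟶ puncturedSpectrum R) [LocallyOfFiniteType f] (x : X) :
    ∃ (B : CommRingCat.{u}) (j : Spec B ⟶ X) (_ : IsOpenImmersion j)
      (φ : CommRingCat.of R ⟶ B) (g : R), x ∈ Set.range j ∧ φ.hom.FiniteType ∧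
      g ∈ maximalIdeal R ∧ IsUnit (φ.hom g) := by
  let i : puncturedSpectrum R ⟶ Spec (CommRingCat.of R) := (puncturedSpectrumOpens R).ι
  have hi : IsOpenImmersion i := inferInstanceAs (IsOpenImmersion (puncturedSpectrumOpens R).ι)
  let h : X ⟶ Spec (CommRingCat.of R) := f ≫ i
  let y : PrimeSpectrum R := h x
  have hy : y ≠ closedPoint R := (f x).2
  obtain ⟨g, hgm, hgy⟩ : ∃ g ∈ maximalIdeal R, g ∉ y.asIdeal := by
    by_contra! hcon
    exact hy (PrimeSpectrum.ext
      ((le_maximalIdeal y.isPrime.ne_top).antisymm fun a ha => hcon a ha))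
  -- Shrinking the chart into the preimage of the basic open set of `g` makes `g` invertible on it:
  -- a maximal ideal containing `g` would be a point mapping outside that set.
  obtain ⟨B, j, hj, hxj, hjU⟩ := Scheme.exists_affine_mem_range_and_range_subset
    (X := X) (x := x) (U := h ⁻¹ᵁ (PrimeSpectrum.basicOpen g)) hgy
  obtain ⟨φ, hφ⟩ : ∃ φ : CommRingCat.of R ⟶ B, Spec.map φ = j ≫ h := ⟨_, Spec.map_preimage _⟩
  refine ⟨B, j, hj, φ, g, hxj, ?_, hgm, ?_⟩
  · rw [← HasRingHomProperty.Spec_iff (P := @LocallyOfFiniteType), hφ]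
    infer_instance
  · by_contra hnu
    obtain ⟨M, hM, hgM⟩ := exists_max_ideal_of_mem_nonunits hnu
    let m : Spec B := (⟨M, hM.isPrime⟩ : PrimeSpectrum B)
    have hmem : h (j m) ∈ PrimeSpectrum.basicOpen g := hjU ⟨_, rfl⟩
    have hm : h (j m) = Spec.map φ m := by
      rw [hφ]; exact (Scheme.Hom.comp_apply j h m).symm
    rw [hm] at hmem
    exact hmem hgM

end Schemes

theorem mainTheorem11 (R : Type u) [CommRing R] [IsLocalRing R] [IsNoetherianRing R]
    [IsAdicComplete (IsLocalRing.maximalIdeal R) R]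
    (X : Scheme.{u}) (f : X ⟶ puncturedSpectrum R) [LocallyOfFiniteType f]
    (hX : IsEquidimensionalSpace X) :
    DimensionFormulaHolds X := by
  choose B j hj φ g hx hφ hg hu using exists_chart_isUnit R X f
  have hjo : ∀ x, Topology.IsOpenEmbedding (j x) := fun x => (j x).isOpenEmbedding
  have hJ : JacobsonSpace X := .of_cover (fun x => j x) hjo (fun x => ⟨x, hx x⟩) fun x => by
    let := (φ x).hom.toAlgebra
    have : Algebra.FiniteType R (B x) := hφ x
    have := isJacobsonRing_of_finiteType_of_isUnit R (B := B x) (hg x) (hu x)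
    infer_instance
  refine HeightAdditive.dimensionFormulaHolds (.of_openCover (fun x => j x) hjo
    (fun x => ⟨x, hx x⟩) fun x => ?_) hX
  let := (φ x).hom.toAlgebra
  have : Algebra.FiniteType R (B x) := hφ x
  exact HeightAdditive.irreducibleCloseds_primeSpectrum R (B := B x) (hg x) (hu x)
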